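/- Let $\Omega$ be a monothetic Cantor group, i.e. a compact, Hausdorff, totally disconnected topological group without isolated points (written additively) that contains a dense cyclic subgroup, and fix $\alpha \in \Omega$ such that $\{n\alpha : n \in \mathbb{Z}\}$ is dense in $\Omega$. For $f \in C(\Omega,\mathbb{R})$ and $\omega \in \Omega$, let $H_{\omega,f}$ be the discrete Schrödinger operator on $\ell^2(\mathbb{Z})$ given by $$[H_{\omega,f}u](n) = u(n-1) + u(n+1) + f(\omega + n\alpha)\,u(n), \qquad n \in \mathbb{Z}.$$ Then the spectrum of $H_{\omega,f}$ does not depend on $\omega$; denote it by $\Sigma(f) \subset \mathbb{R}$. Moreover, there exists a dense $G_\delta$ subset $\mathcal{C}$ of $C(\Omega,\mathbb{R})$ (with the topology of uniform convergence) such that for every $f \in \mathcal{C}$ the set $\Sigma(f)$ is a Cantor set (nonempty, compact, totally disconnected, without isolated points) of zero Lebesgue measure. -/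

import Mathlib

open MeasureTheory
open scoped BoundedContinuousFunction

noncomputable section

/-- The complex Hilbert space `ℓ²(ℤ)`. -/
abbrev EllTwo : Type := lp (fun _ : ℤ => ℂ) 2

theorem EllTwo.memlp_translate (k : ℤ) (u : EllTwo) :
    Memℓp (fun n : ℤ => (u : ℤ → ℂ) (n + k)) 2 := by
  have h := (lp.memℓp u).summable (by norm_num)
  exact memℓp_gen (h.comp_injective (add_left_injective k))

/-- The translation `(translate k u)(n) = u(n + k)` on `ℓ²(ℤ)`. -/
def EllTwo.translate (k : ℤ) : EllTwo →ₗᵢ[ℂ] EllTwo where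
  toFun u := ⟨fun n => u (n + k), EllTwo.memlp_translate k u⟩
  map_add' _ _ := rfl
  map_smul' _ _ := rfl
  norm_map' u := by
    rw [lp.norm_eq_tsum_rpow (by norm_num), lp.norm_eq_tsum_rpow (by norm_num)]
    congr 1
    exact (Equiv.addRight k).tsum_eq (fun n => ‖(u : ℤ → ℂ) n‖ ^ (2 : ENNReal).toReal)

theorem EllTwo.memlp_mul (V : ℤ →ᵇ ℝ) (u : EllTwo) :
    Memℓp (fun n : ℤ => (V n : ℂ) * (u : ℤ → ℂ) n) 2 := by
  have h : Memℓp (fun n : ℤ => (‖V‖ : ℂ) * (u : ℤ → ℂ) n) 2 :=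
    (lp.memℓp u).const_smul (‖V‖ : ℂ)
  have h' := h.summable (by norm_num)
  refine memℓp_gen (h'.of_nonneg_of_le (fun n => by positivity) fun n => ?_)
  refine Real.rpow_le_rpow (norm_nonneg _) ?_ (by norm_num)
  rw [norm_mul, norm_mul, Complex.norm_real, Complex.norm_real, norm_norm]
  exact mul_le_mul_of_nonneg_right (V.norm_coe_le_norm n) (norm_nonneg _)

/-- Multiplication by a bounded real sequence `V` on `ℓ²(ℤ)`. -/
def EllTwo.mulOp (V : ℤ →ᵇ ℝ) : EllTwo →L[ℂ] EllTwo :=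
  LinearMap.mkContinuous
    { toFun := fun u => ⟨fun n => (V n : ℂ) * u n, EllTwo.memlp_mul V u⟩
      map_add' := fun u v => by
        ext n
        exact mul_add _ _ _
      map_smul' := fun c u => by
        ext n
        exact mul_left_comm _ _ _ }
    ‖V‖ (fun u => by
      have h := lp.norm_mono (p := 2) (by norm_num)
        (x := (⟨fun n => (V n : ℂ) * u n, EllTwo.memlp_mul V u⟩ : EllTwo))
        (y := (‖V‖ : ℂ) • u) (fun n => by
          simp only [lp.coeFn_smul, Pi.smul_apply, smul_eq_mul, norm_mul, Complex.norm_real,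
            norm_norm]
          exact mul_le_mul_of_nonneg_right (V.norm_coe_le_norm n) (norm_nonneg _))
      refine h.trans_eq ?_
      rw [norm_smul, Complex.norm_real, norm_norm])

/-- The discrete Schrödinger operator on `ℓ²(ℤ)` with bounded real potential `V`. -/
def schrodingerOp (V : ℤ →ᵇ ℝ) : EllTwo →L[ℂ] EllTwo :=
  (EllTwo.translate (-1)).toContinuousLinearMap + (EllTwo.translate 1).toContinuousLinearMap +
    EllTwo.mulOp V

theorem schrodingerOp_apply (V : ℤ →ᵇ ℝ) (u : EllTwo) (n : ℤ) :
    (schrodingerOp V u : ℤ → ℂ) n = u (n - 1) + u (n + 1) + (V n : ℂ) * u n := rfl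

theorem schrodingerOp_isSelfAdjoint (V : ℤ →ᵇ ℝ) : IsSelfAdjoint (schrodingerOp V) := by
  rw [ContinuousLinearMap.isSelfAdjoint_iff_isSymmetric]
  have hT : ∀ (k : ℤ) (u v : EllTwo),
      inner ℂ (EllTwo.translate k u) v = inner ℂ u (EllTwo.translate (-k) v) := by
    intro k u v
    rw [lp.inner_eq_tsum, lp.inner_eq_tsum]
    rw [← (Equiv.addRight k).tsum_eq (fun n => inner ℂ ((u : ℤ → ℂ) n) _)]
    refine tsum_congr fun n => ?_
    change inner ℂ ((u : ℤ → ℂ) (n + k)) ((v : ℤ → ℂ) n) =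
      inner ℂ ((u : ℤ → ℂ) (n + k)) ((v : ℤ → ℂ) (n + k + -k))
    rw [add_neg_cancel_right]
  have hM : ∀ u v : EllTwo, inner ℂ (EllTwo.mulOp V u) v = inner ℂ u (EllTwo.mulOp V v) := by
    intro u v
    rw [lp.inner_eq_tsum, lp.inner_eq_tsum]
    refine tsum_congr fun n => ?_
    change inner ℂ ((V n : ℂ) * (u : ℤ → ℂ) n) ((v : ℤ → ℂ) n) =
      inner ℂ ((u : ℤ → ℂ) n) ((V n : ℂ) * (v : ℤ → ℂ) n)
    simp only [RCLike.inner_apply, map_mul, Complex.conj_ofReal]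
    ring
  intro u v
  change inner ℂ (EllTwo.translate (-1) u + EllTwo.translate 1 u + EllTwo.mulOp V u) v =
    inner ℂ u (EllTwo.translate (-1) v + EllTwo.translate 1 v + EllTwo.mulOp V v)
  rw [inner_add_left, inner_add_left, inner_add_right, inner_add_right, hT, hT, hM, neg_neg]
  ring

/-- The potential `V_{ω,f}(n) = f(ω + n α)`. -/
def samplingPotential {Ω : Type*} [AddGroup Ω] [TopologicalSpace Ω] [CompactSpace Ω]
    (α : Ω) (f : C(Ω, ℝ)) (ω : Ω) : ℤ →ᵇ ℝ :=
  (BoundedContinuousFunction.mkOfCompact f).compContinuous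
    ⟨fun n : ℤ => ω + n • α, continuous_of_discreteTopology⟩

theorem samplingPotential_apply {Ω : Type*} [AddGroup Ω] [TopologicalSpace Ω] [CompactSpace Ω]
    (α : Ω) (f : C(Ω, ℝ)) (ω : Ω) (n : ℤ) :
    samplingPotential α f ω n = f (ω + n • α) := rfl

/-- The spectrum of the (self-adjoint) operator `H_{ω,f}`, as a subset of the real line. -/
def schrodingerSpectrum {Ω : Type*} [AddGroup Ω] [TopologicalSpace Ω] [CompactSpace Ω]
    (α : Ω) (f : C(Ω, ℝ)) (ω : Ω) : Set ℝ :=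
  {E : ℝ | (E : ℂ) ∈ spectrum ℂ (schrodingerOp (samplingPotential α f ω))}

/-- A Cantor set in the real line: nonempty, compact, perfect and totally disconnected. -/
structure IsCantorSet (K : Set ℝ) : Prop where
  nonempty : K.Nonempty
  isCompact : IsCompact K
  perfect : Perfect K
  totallyDisconnected : IsTotallyDisconnected K

end

/-! The functions with spectrum of measure below `1 / (m + 1)` form an open set, since the spectrum
moves by at most `‖f - g‖` and is compact (`isOpen_volume_spectrum_lt`). Once these sets are dense,
Baire's theorem gives a dense Gδ with null spectrum, and a null set in the line is totally
disconnected. Independence of `ω` and absence of isolated points hold for every `f`, by recurrence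
of the potential under translation.

Density (`exists_small_spectrum`) is the core. Open subgroups form a neighbourhood basis of `0` and
`α` has finite order modulo each, so periodic sampling functions are dense. Near a periodic `f`, any
prescribed energy can be moved into a gap (`exists_gap`): at a large multiple of the period the
discriminant reaches `2` inside the interval, and if no perturbation supported on one site per
period opened a gap there, the Dirichlet polynomial would have a double zero, against a Wronskian
inequality.

By compactness, finitely many such periodic functions have gaps covering all relevant energies.
Their potentials are concatenated in blocks of length `2R` inside one long period `N`, with `N`
comparable to `R`. At an energy in the gap of one block, an approximate eigenfunction carries mass
only `O(1/R²)` at the centre of that block, so cutting the lattice there moves the energy by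
`O(1/R²)` (`exists_root_near`). The cut operator has at most `N` spectral values, whence total
measure `O(N/R²) = O(1/R)` (`exists_small_spectrum_of_gaps`). -/

theorem ofReal_mem_spectrum_iff {A : Type*} [Ring A] [Algebra ℂ A] {a : A} {E : ℝ} :
    (E : ℂ) ∈ spectrum ℂ a ↔ E ∈ spectrum ℝ a :=
  spectrum.algebraMap_mem_iff (R := ℝ) (r := E) ℂ

/-! ### Approximate eigenvectors and spectral gaps of self-adjoint operators. -/

section SelfAdjoint

variable {H : Type*} [NormedAddCommGroup H] [InnerProductSpace ℂ H] [CompleteSpace H]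

theorem IsSelfAdjoint.nonempty_spectrum_real [Nontrivial (H →L[ℂ] H)] {T : H →L[ℂ] H}
    (hT : IsSelfAdjoint T) : (spectrum ℝ T).Nonempty :=
  ContinuousFunctionalCalculus.spectrum_nonempty T hT

theorem cfc_ne_zero_of_mem_spectrum {T : H →L[ℂ] H} (hT : IsSelfAdjoint T) {E : ℝ}
    (hE : E ∈ spectrum ℝ T) {g : ℝ → ℝ} (hg : Continuous g) (hgE : g E ≠ 0) : cfc g T ≠ 0 := by
  intro h0
  have h1 : g E ∈ spectrum ℝ (cfc g T) := by
    rw [cfc_map_spectrum g T hT hg.continuousOn]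
    exact ⟨E, hE, rfl⟩
  have : Nontrivial (H →L[ℂ] H) := by
    refine ⟨⟨1, 0, fun h => ?_⟩⟩
    have hs : Subsingleton (H →L[ℂ] H) := subsingleton_of_zero_eq_one h.symm
    rw [spectrum.of_subsingleton] at hE
    exact hE
  rw [h0, spectrum.zero_eq] at h1
  exact hgE h1

/-- The range of a tent function `g` of `T` centred at `E` consists of such vectors: on the support
of `g`, `x - E` equals its truncation `c`, and `cfc c T` has norm at most `ε`. -/
theorem exists_approx_eigenvector {T : H →L[ℂ] H} (hT : IsSelfAdjoint T) {E : ℝ}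
    (hE : E ∈ spectrum ℝ T) {ε : ℝ} (hε : 0 < ε) :
    ∃ u : H, u ≠ 0 ∧ ‖T u - (E : ℂ) • u‖ ≤ ε * ‖u‖ := by
  set g : ℝ → ℝ := fun x => max 0 (1 - |x - E| / ε) with hg
  set c : ℝ → ℝ := fun x => max (-ε) (min ε (x - E)) with hc
  have hgc : Continuous g := by fun_prop
  have hcc : Continuous c := by fun_prop
  have hP : cfc g T ≠ 0 := cfc_ne_zero_of_mem_spectrum hT hE hgc (by simp [hg])
  obtain ⟨v, hv⟩ : ∃ v, cfc g T v ≠ 0 := by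
    by_contra! h
    exact hP (ContinuousLinearMap.ext h)
  refine ⟨cfc g T v, hv, ?_⟩
  have h1 : (T - algebraMap ℝ (H →L[ℂ] H) E) * cfc g T = cfc c T * cfc g T := by
    have h2 : T - algebraMap ℝ (H →L[ℂ] H) E = cfc (fun x => x - E) T := by
      rw [cfc_sub (fun x : ℝ => x) (fun _ => E) T, cfc_id' ℝ T, cfc_const E T]
    rw [h2, ← cfc_mul _ _ T (by fun_prop) hgc.continuousOn,
      ← cfc_mul _ _ T hcc.continuousOn hgc.continuousOn]
    congr 1
    funext x
    by_cases hx : |x - E| ≤ ε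
    · have := abs_le.1 hx
      simp only [hc]
      rw [min_eq_right this.2, max_eq_right this.1]
    · have : g x = 0 := by
        simp only [hg]
        apply max_eq_left
        rw [sub_nonpos, le_div_iff₀ hε]
        linarith
      rw [this]; simp
  have h2 := congrArg (fun S : H →L[ℂ] H => S v) h1
  have h3 : T (cfc g T v) - (E : ℂ) • cfc g T v = cfc c T (cfc g T v) := by
    simpa [Algebra.algebraMap_eq_smul_one] using h2
  rw [h3]
  refine (ContinuousLinearMap.le_opNorm _ _).trans ?_
  refine mul_le_mul_of_nonneg_right ?_ (norm_nonneg _)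
  refine norm_cfc_le hε.le fun x _ => ?_
  rw [Real.norm_eq_abs, abs_le]
  exact ⟨le_max_left _ _, max_le (by linarith) (min_le_left _ _)⟩

theorem mul_norm_le_of_dist_spectrum {T : H →L[ℂ] H} (hT : IsSelfAdjoint T) {E δ : ℝ}
    (hδ : 0 < δ) (h : ∀ x ∈ spectrum ℝ T, δ ≤ |x - E|) (u : H) :
    δ * ‖u‖ ≤ ‖T u - (E : ℂ) • u‖ := by
  have hne : ∀ x ∈ spectrum ℝ T, x - E ≠ 0 := fun x hx h0 => by
    have := h x hx
    rw [h0, abs_zero] at this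
    linarith
  have hcont : ContinuousOn (fun x : ℝ => (x - E)⁻¹) (spectrum ℝ T) :=
    ContinuousOn.inv₀ (by fun_prop) hne
  have h1 : cfc (fun x : ℝ => (x - E)⁻¹) T * (T - algebraMap ℝ (H →L[ℂ] H) E) = 1 := by
    have h2 : T - algebraMap ℝ (H →L[ℂ] H) E = cfc (fun x => x - E) T := by
      rw [cfc_sub (fun x : ℝ => x) (fun _ => E) T, cfc_id' ℝ T, cfc_const E T]
    rw [h2, ← cfc_mul _ _ T hcont (by fun_prop)]
    rw [← cfc_one ℝ T]
    exact cfc_congr fun x hx => inv_mul_cancel₀ (hne x hx)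
  have h2 := congrArg (fun S : H →L[ℂ] H => S u) h1
  have h3 : cfc (fun x : ℝ => (x - E)⁻¹) T (T u - (E : ℂ) • u) = u := by
    simpa [Algebra.algebraMap_eq_smul_one] using h2
  have h4 : ‖cfc (fun x : ℝ => (x - E)⁻¹) T‖ ≤ δ⁻¹ := by
    refine norm_cfc_le (inv_nonneg.2 hδ.le) fun x hx => ?_
    rw [norm_inv]
    exact inv_anti₀ hδ (h x hx)
  have h5 := (cfc (fun x : ℝ => (x - E)⁻¹) T).le_of_opNorm_le h4 (T u - (E : ℂ) • u)
  rw [h3, inv_mul_eq_div, le_div_iff₀ hδ] at h5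
  linarith

/-- An approximate eigenvector with error `η` forces spectrum within distance `η`. -/
theorem exists_mem_spectrum_abs_sub_le {T : H →L[ℂ] H} (hT : IsSelfAdjoint T) {E η : ℝ} {u : H}
    (hu : u ≠ 0) (h : ‖T u - (E : ℂ) • u‖ < η * ‖u‖) :
    ∃ x ∈ spectrum ℝ T, |x - E| < η := by
  by_contra! hcon
  have hη : 0 < η := by
    have := (norm_nonneg _).trans_lt h
    exact (pos_iff_pos_of_mul_pos this).2 (norm_pos_iff.2 hu)
  exact absurd (mul_norm_le_of_dist_spectrum hT hη hcon u) (not_le.2 h)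

theorem exists_mem_spectrum_of_norm_sub_lt {T S : H →L[ℂ] H} (hT : IsSelfAdjoint T)
    (hS : IsSelfAdjoint S) {δ : ℝ} (hTS : ‖T - S‖ < δ) {E : ℝ} (hE : E ∈ spectrum ℝ T) :
    ∃ x ∈ spectrum ℝ S, |x - E| < δ := by
  obtain ⟨u, hu, h⟩ := exists_approx_eigenvector hT hE (ε := (δ - ‖T - S‖) / 2) (by linarith)
  refine exists_mem_spectrum_abs_sub_le hS hu ?_
  have h1 : S u - (E : ℂ) • u = (T u - (E : ℂ) • u) - (T - S) u := by
    simp only [sub_apply]; abel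
  have hu' := norm_pos_iff.2 hu
  rw [h1]
  calc _ ≤ ‖T u - (E : ℂ) • u‖ + ‖(T - S) u‖ := norm_sub_le _ _
    _ ≤ (δ - ‖T - S‖) / 2 * ‖u‖ + ‖T - S‖ * ‖u‖ := add_le_add h ((T - S).le_opNorm u)
    _ < δ * ‖u‖ := by nlinarith

/-- An isolated point of the spectrum is an eigenvalue, and vectors are close to the eigenspace
when they are approximate eigenvectors. -/
theorem exists_projection_of_isolated {T : H →L[ℂ] H} (hT : IsSelfAdjoint T) {E δ : ℝ}
    (hδ : 0 < δ) (hE : E ∈ spectrum ℝ T) (h : ∀ x ∈ spectrum ℝ T, x ≠ E → δ ≤ |x - E|) :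
    ∃ P B : H →L[ℂ] H, P ≠ 0 ∧ (∀ u, T (P u) = (E : ℂ) • P u) ∧
      ∀ u, u - P u = B (T u - (E : ℂ) • u) := by
  -- On the spectrum `g` is the indicator of `E`, while `b` is the inverse of `x - E` away from `E`
  -- and `0` at `E`; both are continuous on the whole line.
  set g : ℝ → ℝ := fun x => max 0 (1 - |x - E| / δ) with hg
  set b : ℝ → ℝ := fun x => (x - E) / (max |x - E| δ) ^ 2 with hb
  have hgc : Continuous g := by fun_prop
  have hbc : Continuous b :=
    Continuous.div (by fun_prop) (by fun_prop) fun x =>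
      pow_ne_zero _ (lt_max_of_lt_right hδ).ne'
  have hg0 : ∀ x ∈ spectrum ℝ T, x ≠ E → g x = 0 := fun x hx hxE => by
    simp only [hg]
    apply max_eq_left
    rw [sub_nonpos, le_div_iff₀ hδ]
    linarith [h x hx hxE]
  have hgE : g E = 1 := by simp [hg]
  have hsub : T - algebraMap ℝ (H →L[ℂ] H) E = cfc (fun x => x - E) T := by
    rw [cfc_sub (fun x : ℝ => x) (fun _ => E) T, cfc_id' ℝ T, cfc_const E T]
  have h1 : (T - algebraMap ℝ (H →L[ℂ] H) E) * cfc g T = 0 := by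
    rw [hsub, ← cfc_mul _ _ T (by fun_prop) hgc.continuousOn, ← cfc_zero ℝ T]
    refine cfc_congr fun x hx => ?_
    by_cases hxE : x = E
    · simp [hxE]
    · simp [hg0 x hx hxE]
  have h2 : cfc b T * (T - algebraMap ℝ (H →L[ℂ] H) E) = 1 - cfc g T := by
    rw [hsub, ← cfc_mul _ _ T hbc.continuousOn (by fun_prop), ← cfc_one ℝ T,
      ← cfc_sub _ _ T (by fun_prop) hgc.continuousOn]
    refine cfc_congr fun x hx => ?_
    by_cases hxE : x = E
    · simp [hxE, hgE]
    · have hx' : x - E ≠ 0 := sub_ne_zero.2 hxE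
      simp only [hb, hg0 x hx hxE, max_eq_left (h x hx hxE), sq_abs, Pi.one_apply]
      field_simp
      simp
  refine ⟨cfc g T, cfc b T, cfc_ne_zero_of_mem_spectrum hT hE hgc (by simp [hgE]), fun u => ?_,
    fun u => ?_⟩
  · have := congrArg (fun S : H →L[ℂ] H => S u) h1
    exact sub_eq_zero.1 (by simpa [Algebra.algebraMap_eq_smul_one] using this)
  · have := congrArg (fun S : H →L[ℂ] H => S u) h2
    simpa [Algebra.algebraMap_eq_smul_one] using this.symm

end SelfAdjoint

/-! ### Transfer matrices, discriminants and Dirichlet polynomials. -/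

section Transfer

open Polynomial

/-- The one-step transfer matrix at the site `n`, with polynomial entries in the energy. -/
noncomputable def transferStep (V : ℤ → ℝ) (n : ℤ) : Matrix (Fin 2) (Fin 2) ℝ[X] :=
  !![X - C (V n), -1; 1, 0]

/-- The transfer matrix across the sites `n, …, n + k - 1`. -/
noncomputable def transferMatrix (V : ℤ → ℝ) (n : ℤ) : ℕ → Matrix (Fin 2) (Fin 2) ℝ[X]
  | 0 => 1
  | k + 1 => transferStep V (n + k) * transferMatrix V n k

/-- The discriminant: the trace of the transfer matrix across `q` sites from `0`. -/
noncomputable def discriminant (V : ℤ → ℝ) (q : ℕ) : ℝ[X] := (transferMatrix V 0 q).trace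

theorem transferMatrix_det (V : ℤ → ℝ) (n : ℤ) (k : ℕ) : (transferMatrix V n k).det = 1 := by
  induction k with
  | zero => simp [transferMatrix]
  | succ k ih =>
    rw [transferMatrix, Matrix.det_mul, ih, transferStep, Matrix.det_fin_two_of]
    simp

theorem transferMatrix_congr {V W : ℤ → ℝ} {n m : ℤ} {k : ℕ}
    (h : ∀ j : ℕ, j < k → V (n + j) = W (m + j)) :
    transferMatrix V n k = transferMatrix W m k := by
  induction k with
  | zero => rfl
  | succ k ih =>
    rw [transferMatrix, transferMatrix, ih fun j hj => h j (by omega), transferStep, transferStep,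
      h k (by omega)]

theorem transferMatrix_add (V : ℤ → ℝ) (n : ℤ) (k l : ℕ) :
    transferMatrix V n (k + l) = transferMatrix V (n + k) l * transferMatrix V n k := by
  induction l with
  | zero => simp [transferMatrix]
  | succ l ih =>
    rw [← add_assoc, transferMatrix, transferMatrix, ih, mul_assoc]
    push_cast
    rw [add_assoc]

theorem transferMatrix_succ' (V : ℤ → ℝ) (n : ℤ) (k : ℕ) :
    transferMatrix V n (k + 1) = transferMatrix V (n + 1) k * transferStep V n := by
  rw [add_comm, transferMatrix_add]
  simp [transferMatrix]

/-- Moving the base point by one site moves a factor from one end of the product to the other, which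
the trace does not see. -/
theorem trace_transferMatrix {V : ℤ → ℝ} {q : ℕ} (hV : ∀ n, V (n + q) = V n) (n : ℤ) :
    (transferMatrix V n q).trace = discriminant V q := by
  have step : ∀ n : ℤ, (transferMatrix V (n + 1) q).trace = (transferMatrix V n q).trace := by
    intro n
    cases q with
    | zero => rfl
    | succ k =>
      rw [transferMatrix_succ' V n, transferMatrix, Matrix.trace_mul_comm]
      have : V (n + 1 + k) = V n := by rw [← hV n]; congr 1; push_cast; ring
      rw [transferStep, transferStep, this]
  induction n using Int.induction_on with
  | zero => rfl
  | succ n ih => rw [step, ih]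
  | pred n ih => rw [← ih, ← step, sub_add_cancel]

theorem transferMatrix_mul_period {V : ℤ → ℝ} {p : ℕ} (hV : ∀ n, V (n + p) = V n) (k : ℕ) :
    transferMatrix V 0 (k * p) = transferMatrix V 0 p ^ k := by
  induction k with
  | zero => simp [transferMatrix]
  | succ k ih =>
    rw [add_mul, one_mul, transferMatrix_add, ih, pow_succ']
    congr 1
    apply transferMatrix_congr
    intro j _
    have := (Function.Periodic.nat_mul hV k) (0 + j)
    rw [← this]
    congr 1; push_cast; ring

theorem sq_eq_trace_smul_sub_one {R : Type*} [CommRing R] (M : Matrix (Fin 2) (Fin 2) R)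
    (hM : M.det = 1) : M ^ 2 = M.trace • M - 1 := by
  rw [Matrix.det_fin_two] at hM
  rw [sq]
  ext i j
  fin_cases i <;> fin_cases j <;>
    simp [Matrix.mul_apply, Matrix.trace_fin_two, Fin.sum_univ_two, ← hM] <;> ring

/-- By Cayley–Hamilton, the traces of powers satisfy the Chebyshev recurrence. -/
theorem trace_pow_of_trace_eq_two_cos (M : Matrix (Fin 2) (Fin 2) ℝ) (hM : M.det = 1) {θ : ℝ}
    (hθ : M.trace = 2 * Real.cos θ) (k : ℕ) : (M ^ k).trace = 2 * Real.cos (k * θ) := by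
  induction k using Nat.twoStepInduction with
  | zero => simp
  | one => simpa using hθ
  | more k ih1 ih2 =>
    have h : M ^ (k + 2) = M.trace • M ^ (k + 1) - M ^ k := by
      rw [pow_add, sq_eq_trace_smul_sub_one M hM, mul_sub, mul_one, mul_smul_comm, pow_succ]
    rw [h, Matrix.trace_sub, Matrix.trace_smul, ih1, ih2, hθ, smul_eq_mul]
    push_cast
    have h1 : ((k : ℝ) + 2) * θ = (k + 1) * θ + θ := by ring
    have h2 : (k : ℝ) * θ = (k + 1) * θ - θ := by ring
    rw [h1, h2, Real.cos_add, Real.cos_sub]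
    ring

theorem eval_discriminant_mul_period {V : ℤ → ℝ} {p : ℕ} (hV : ∀ n, V (n + p) = V n) {E θ : ℝ}
    (hθ : (discriminant V p).eval E = 2 * Real.cos θ) (k : ℕ) :
    (discriminant V (k * p)).eval E = 2 * Real.cos (k * θ) := by
  have htr : ∀ M : Matrix (Fin 2) (Fin 2) ℝ[X], M.trace.eval E =
      ((evalRingHom E).mapMatrix M).trace := fun M => by
    simp [Matrix.trace_fin_two]
  rw [discriminant, htr] at hθ ⊢
  rw [transferMatrix_mul_period hV, map_pow]
  refine trace_pow_of_trace_eq_two_cos _ ?_ hθ k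
  rw [← RingHom.map_det, transferMatrix_det, map_one]

/-- The solution of the difference equation vanishing at the site `c` and equal to `1` at the next
site, evaluated at `c + j`, as a polynomial in the energy. -/
noncomputable def dirichletPoly (V : ℤ → ℝ) (c : ℤ) : ℕ → ℝ[X]
  | 0 => 0
  | 1 => 1
  | j + 2 => (X - C (V (c + (j + 1 : ℕ)))) * dirichletPoly V c (j + 1) - dirichletPoly V c j

theorem transferMatrix_col (V : ℤ → ℝ) (c : ℤ) (j : ℕ) :
    transferMatrix V (c + 1) j 0 0 = dirichletPoly V c (j + 1) ∧
      transferMatrix V (c + 1) j 1 0 = dirichletPoly V c j := by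
  induction j with
  | zero => simp [transferMatrix, dirichletPoly]
  | succ j ih =>
    have h : c + 1 + (j : ℤ) = c + ((j + 1 : ℕ) : ℤ) := by push_cast; ring
    rw [transferMatrix, dirichletPoly, ← ih.1, ← ih.2, transferStep, h]
    simp [Matrix.mul_apply, Fin.sum_univ_two, sub_eq_add_neg]

theorem natDegree_dirichletPoly_le (V : ℤ → ℝ) (c : ℤ) (j : ℕ) :
    (dirichletPoly V c j).natDegree ≤ j - 1 := by
  induction j using Nat.twoStepInduction with
  | zero => simp [dirichletPoly]
  | one => simp [dirichletPoly]
  | more j ih1 ih2 =>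
    rw [dirichletPoly]
    refine (natDegree_sub_le _ _).trans (max_le (natDegree_mul_le.trans ?_) (by omega))
    rw [natDegree_X_sub_C]
    omega

/-- Christoffel–Darboux: the expression equals `1` at the start and each step adds a square. Hence
these polynomials have no double zeros. -/
theorem dirichletPoly_wronskian (V : ℤ → ℝ) (c : ℤ) (E : ℝ) (j : ℕ) :
    1 ≤ (derivative (dirichletPoly V c (j + 2))).eval E * (dirichletPoly V c (j + 1)).eval E -
      (dirichletPoly V c (j + 2)).eval E * (derivative (dirichletPoly V c (j + 1))).eval E := by
  induction j with
  | zero => simp [dirichletPoly]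
  | succ j ih =>
    rw [dirichletPoly]
    simp only [derivative_sub, derivative_mul, derivative_X, derivative_C, eval_add, eval_sub,
      eval_mul, eval_X, eval_C, eval_one, eval_zero]
    nlinarith [sq_nonneg ((dirichletPoly V c (j + 1 + 1)).eval E)]

theorem dirichletPoly_ne_zero (V : ℤ → ℝ) (c : ℤ) {j : ℕ} (hj : 2 ≤ j) :
    dirichletPoly V c j ≠ 0 := by
  obtain ⟨i, rfl⟩ := Nat.exists_eq_add_of_le' hj
  intro h
  have := dirichletPoly_wronskian V c 0 i
  rw [h] at this
  simp at this
  linarith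

/-- Only site `0` of the period is changed, and the trace is affine in the potential there. -/
theorem discriminant_eq_sub {V W : ℤ → ℝ} {q : ℕ} (hq : 0 < q) {t : ℝ}
    (hW : ∀ n, W n = V n + if (q : ℤ) ∣ n then t else 0) :
    discriminant W q = discriminant V q - C t * dirichletPoly V 0 q := by
  obtain ⟨k, rfl⟩ := Nat.exists_eq_add_of_le' hq
  have h1 : transferMatrix W (0 + 1) k = transferMatrix V (0 + 1) k := by
    apply transferMatrix_congr
    intro j hj
    rw [hW, if_neg, add_zero]
    intro hd
    have := Int.le_of_dvd (by omega) hd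
    push_cast at this
    omega
  have h2 : W 0 = V 0 + t := by rw [hW]; simp
  rw [discriminant, discriminant, transferMatrix_succ', transferMatrix_succ', h1,
    ← (transferMatrix_col V 0 k).1, transferStep, transferStep, h2]
  simp [Matrix.trace_fin_two, Matrix.mul_apply, Fin.sum_univ_two]
  ring

end Transfer

/-! ### Periodic operators and the opening of gaps. -/

section Periodic

open Polynomial

theorem aeval_mul_X_apply (T : EllTwo →L[ℂ] EllTwo) (p : ℝ[X]) (u : EllTwo) :
    aeval T (p * X) u = aeval T p (T u) := by
  simp

theorem aeval_sub_apply (T : EllTwo →L[ℂ] EllTwo) (p r : ℝ[X]) (u : EllTwo) (n : ℤ) :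
    (aeval T (p - r) u : ℤ → ℂ) n = (aeval T p u : ℤ → ℂ) n - (aeval T r u : ℤ → ℂ) n := by
  simp

theorem aeval_add_apply (T : EllTwo →L[ℂ] EllTwo) (p r : ℝ[X]) (u : EllTwo) (n : ℤ) :
    (aeval T (p + r) u : ℤ → ℂ) n = (aeval T p u : ℤ → ℂ) n + (aeval T r u : ℤ → ℂ) n := by
  simp

theorem aeval_C_mul_apply (T : EllTwo →L[ℂ] EllTwo) (c : ℝ) (p : ℝ[X]) (u : EllTwo) (n : ℤ) :
    (aeval T (C c * p) u : ℤ → ℂ) n = (c : ℂ) * (aeval T p u : ℤ → ℂ) n := by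
  rw [map_mul, aeval_C, Algebra.algebraMap_eq_smul_one]
  simp

theorem aeval_X_sub_C_mul_apply (T : EllTwo →L[ℂ] EllTwo) (c : ℝ) (p : ℝ[X]) (u : EllTwo)
    (n : ℤ) : (aeval T ((X - C c) * p) u : ℤ → ℂ) n =
      (aeval T p (T u) : ℤ → ℂ) n - (c : ℂ) * (aeval T p u : ℤ → ℂ) n := by
  rw [sub_mul, aeval_sub_apply, mul_comm X, aeval_mul_X_apply, aeval_C_mul_apply]

/-- With the operator in place of the energy, the transfer recursion holds for every `u`, not only
for solutions. -/
theorem apply_add_eq_transferMatrix (V : ℤ →ᵇ ℝ) (n : ℤ) (k : ℕ) (u : EllTwo) :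
    u (n + k) = (aeval (schrodingerOp V) (transferMatrix V n k 0 0) u : ℤ → ℂ) n +
        (aeval (schrodingerOp V) (transferMatrix V n k 0 1) u : ℤ → ℂ) (n - 1) ∧
      u (n + k - 1) = (aeval (schrodingerOp V) (transferMatrix V n k 1 0) u : ℤ → ℂ) n +
        (aeval (schrodingerOp V) (transferMatrix V n k 1 1) u : ℤ → ℂ) (n - 1) := by
  induction k generalizing u with
  | zero => simp [transferMatrix]
  | succ k ih =>
    have h0 : ∀ i, transferMatrix V n (k + 1) 0 i =
        (X - C (V (n + k))) * transferMatrix V n k 0 i - transferMatrix V n k 1 i := fun i => by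
      simp [transferMatrix, transferStep, Matrix.mul_apply, Fin.sum_univ_two, sub_eq_add_neg]
    have h1 : ∀ i, transferMatrix V n (k + 1) 1 i = transferMatrix V n k 0 i := fun i => by
      simp [transferMatrix, transferStep, Matrix.mul_apply, Fin.sum_univ_two]
    have e1 : n + ((k + 1 : ℕ) : ℤ) = n + k + 1 := by push_cast; ring
    refine ⟨?_, ?_⟩
    · rw [h0, h0, aeval_sub_apply, aeval_sub_apply, aeval_X_sub_C_mul_apply,
        aeval_X_sub_C_mul_apply, e1]
      have h2 := (ih (schrodingerOp V u)).1
      rw [schrodingerOp_apply] at h2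
      linear_combination h2 - (V (n + k) : ℂ) * (ih u).1 - (ih u).2
    · rw [h1, h1, e1, add_sub_cancel_right]
      exact (ih u).1

/-- The transfer matrix gives `u (n + q)`; its adjugate, which is its inverse since the determinant
is `1`, gives `u (n - q)`. In the sum the off-diagonal terms cancel and the trace remains. -/
theorem aeval_discriminant {V : ℤ →ᵇ ℝ} {q : ℕ} (hV : ∀ n, V (n + q) = V n) :
    aeval (schrodingerOp V) (discriminant V q) =
      (EllTwo.translate q).toContinuousLinearMap +
        (EllTwo.translate (-q)).toContinuousLinearMap := by
  ext u n
  have hM : transferMatrix V (n - q) q = transferMatrix V n q :=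
    transferMatrix_congr fun j _ => by rw [← hV]; congr 1; ring
  have htr := trace_transferMatrix hV n
  have hdet := transferMatrix_det V n q
  have h1 := (apply_add_eq_transferMatrix V n q u).1
  have h2 := fun w => apply_add_eq_transferMatrix V (n - q) q w
  rw [hM] at h2
  generalize transferMatrix V n q = M at *
  rw [Matrix.trace_fin_two] at htr
  rw [Matrix.det_fin_two] at hdet
  have h3 := (h2 (aeval (schrodingerOp V) (M 1 1) u)).1
  have h4 := (h2 (aeval (schrodingerOp V) (M 0 1) u)).2
  have hmul : ∀ a b : ℝ[X], aeval (schrodingerOp V) a (aeval (schrodingerOp V) b u) =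
      aeval (schrodingerOp V) (a * b) u := fun a b => by simp
  rw [hmul, hmul, sub_add_cancel] at h3 h4
  have h5 : (aeval (schrodingerOp V) (M 0 0 * M 1 1 - M 1 0 * M 0 1) u : ℤ → ℂ) (n - q) =
      u (n - q) := by
    rw [mul_comm (M 1 0), hdet]; simp
  rw [aeval_sub_apply] at h5
  rw [mul_comm (M 1 1) (M 0 1)] at h4
  rw [← htr, aeval_add_apply]
  change _ = u (n + q) + u (n + -q)
  rw [← sub_eq_add_neg]
  linear_combination h3 - h4 + h5 - h1

theorem abs_eval_discriminant_le {V : ℤ →ᵇ ℝ} {q : ℕ} (hV : ∀ n, V (n + q) = V n) {E : ℝ}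
    (hE : E ∈ spectrum ℝ (schrodingerOp V)) : |(discriminant V q).eval E| ≤ 2 := by
  have h := spectrum.subset_polynomial_aeval (schrodingerOp V) (discriminant V q) ⟨E, hE, rfl⟩
  rw [aeval_discriminant hV] at h
  have h2 := spectrum.norm_le_norm_mul_of_mem h
  have h3 : ‖(1 : EllTwo →L[ℂ] EllTwo)‖ ≤ 1 := ContinuousLinearMap.norm_id_le
  have h4 := norm_add_le (EllTwo.translate q).toContinuousLinearMap
        (EllTwo.translate (-q)).toContinuousLinearMap
  have h5 := (EllTwo.translate q).norm_toContinuousLinearMap_le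
  have h6 := (EllTwo.translate (-q)).norm_toContinuousLinearMap_le
  have h7 := norm_nonneg ((EllTwo.translate q).toContinuousLinearMap +
        (EllTwo.translate (-q)).toContinuousLinearMap)
  rw [Real.norm_eq_abs] at h2
  nlinarith

theorem discriminant_ne_C {V : ℤ →ᵇ ℝ} {q : ℕ} (hq : 0 < q) (hV : ∀ n, V (n + q) = V n) (c : ℝ) :
    discriminant V q ≠ C c := by
  intro h
  have h1 := aeval_discriminant hV
  rw [h, aeval_C, Algebra.algebraMap_eq_smul_one] at h1
  have h2 := congrArg (fun T : EllTwo →L[ℂ] EllTwo => (T (lp.single 2 0 1) : ℤ → ℂ) q) h1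
  change _ = (lp.single 2 (0 : ℤ) (1 : ℂ) : EllTwo) (q + q) +
    (lp.single 2 (0 : ℤ) (1 : ℂ) : EllTwo) (q + -q) at h2
  have h3 : ((q : ℤ) + q) ≠ 0 := by omega
  simp [lp.single_apply, h3, hq.ne'] at h2

/-- A closed band interval can be broken by an arbitrarily small perturbation supported on
`qℤ`, for every large multiple `q` of the period. -/
theorem exists_gap {V : ℤ →ᵇ ℝ} {p : ℕ} (hp : 0 < p) (hV : ∀ n, V (n + p) = V n) {a b : ℝ}
    (hab : a < b) : ∃ k₀ : ℕ, ∀ k ≥ k₀, ∀ ε > 0, ∃ t : ℝ, |t| ≤ ε ∧ ∃ E ∈ Set.Ioo a b,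
      ∀ W : ℤ →ᵇ ℝ, (∀ n, W n = V n + if ((k * p : ℕ) : ℤ) ∣ n then t else 0) →
        E ∉ spectrum ℝ (schrodingerOp W) := by
  by_cases hsub : ∀ E ∈ Set.Ioo a b, E ∈ spectrum ℝ (schrodingerOp V)
  swap
  · push Not at hsub
    obtain ⟨E, hE, hES⟩ := hsub
    refine ⟨0, fun k _ ε hε => ⟨0, by simpa using hε.le, E, hE, fun W hW => ?_⟩⟩
    have : W = V := by ext n; simp [hW]
    rwa [this]
  have hD : ∀ E ∈ Set.Ioo a b, |(discriminant V p).eval E| ≤ 2 := fun E hE =>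
    abs_eval_discriminant_le hV (hsub E hE)
  -- `θ` is the Floquet phase: the discriminant over `k` periods is `2 cos (k θ)`. It is not
  -- constant on the interval, because the discriminant is not a constant polynomial.
  set θ : ℝ → ℝ := fun E => Real.arccos ((discriminant V p).eval E / 2) with hθ
  have hθc : Continuous θ := Real.continuous_arccos.comp
    ((discriminant V p).continuous.div_const 2)
  have hcos : ∀ E ∈ Set.Ioo a b, (discriminant V p).eval E = 2 * Real.cos (θ E) := by
    intro E hE
    have := abs_le.1 (hD E hE)
    simp only [hθ]
    rw [Real.cos_arccos (by linarith) (by linarith)]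
    ring
  obtain ⟨x, hx, y, hy, hxy⟩ : ∃ x ∈ Set.Ioo a b, ∃ y ∈ Set.Ioo a b, θ x < θ y := by
    by_contra! hcon
    obtain ⟨m, hm⟩ : (Set.Ioo a b).Nonempty := Set.nonempty_Ioo.2 hab
    refine discriminant_ne_C hp hV ((discriminant V p).eval m) ?_
    refine eq_of_infinite_eval_eq _ _ ((Set.Ioo_infinite hab).mono fun E hE => ?_)
    have : θ E = θ m := le_antisymm (hcon m hm E hE) (hcon E hE m hm)
    simp only [Set.mem_ofPred_eq, eval_C]
    rw [hcos E hE, hcos m hm, this]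
  obtain ⟨k₀, hk₀⟩ := exists_nat_gt (2 * Real.pi / (θ y - θ x))
  -- Beyond `k₀` the phase `k θ` sweeps more than a full turn, so it meets a multiple of `2π`; the
  -- `2` ensures `k * p ≥ 2`, as the Wronskian inequality needs.
  refine ⟨max k₀ 2, fun k hk ε hε => ?_⟩
  by_contra! hcon
  have hk2 : 2 ≤ k := (le_max_right _ _).trans hk
  have hkk : (k₀ : ℝ) ≤ k := by exact_mod_cast (le_max_left _ _).trans hk
  have hkx : 2 * Real.pi < k * θ y - k * θ x := by
    rw [← mul_sub]
    rw [div_lt_iff₀ (by linarith)] at hk₀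
    nlinarith
  have hpi := Real.pi_pos
  obtain ⟨j, hj1, hj2⟩ : ∃ j : ℤ, k * θ x ≤ j * (2 * Real.pi) ∧ j * (2 * Real.pi) ≤ k * θ y := by
    refine ⟨⌈k * θ x / (2 * Real.pi)⌉, ?_, ?_⟩
    · rw [← div_le_iff₀ (by positivity)]
      exact Int.le_ceil _
    · have := Int.ceil_lt_add_one (k * θ x / (2 * Real.pi))
      have h2 : k * θ x / (2 * Real.pi) * (2 * Real.pi) = k * θ x := by field_simp
      nlinarith
  obtain ⟨E, hExy, hE⟩ : ∃ E ∈ Set.uIcc x y, k * θ E = j * (2 * Real.pi) := by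
    have hc : ContinuousOn (fun E => k * θ E) (Set.uIcc x y) :=
      (continuous_const.mul hθc).continuousOn
    exact intermediate_value_uIcc hc (Set.Icc_subset_uIcc ⟨hj1, hj2⟩)
  have hEI : E ∈ Set.Ioo a b := Set.ordConnected_Ioo.uIcc_subset hx hy hExy
  have hq : 0 < k * p := by positivity
  have hq2 : 2 ≤ k * p := by nlinarith
  have hD2 : (discriminant V (k * p)).eval E = 2 := by
    rw [eval_discriminant_mul_period hV (hcos E hEI), hE, Real.cos_int_mul_two_pi, mul_one]
  set G := dirichletPoly V 0 (k * p) with hG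
  have hVper : ∀ n, V (n + (k * p : ℕ)) = V n := by
    intro n
    have := (Function.Periodic.nat_mul hV k) n
    rw [← this]; push_cast; rfl
  have key : ∀ t : ℝ, |t| ≤ ε → ∀ x ∈ Set.Ioo a b,
      (discriminant V (k * p) - C t * G).eval x ≤ 2 := by
    intro t ht x hx
    obtain ⟨W, hW, hxW⟩ := hcon t ht x hx
    have hWper : ∀ n, W (n + (k * p : ℕ)) = W n := by
      intro n
      rw [hW, hW, hVper]
      simp
    rw [hG, ← discriminant_eq_sub hq hW]
    exact (abs_le.1 (abs_eval_discriminant_le hWper hxW)).2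
  -- The discriminant is already `2` at `E`, and perturbations of either sign must not raise it.
  have hG0 : G.eval E = 0 := by
    have h1 := key ε (by rw [abs_of_pos hε]) E hEI
    have h2 := key (-ε) (by rw [abs_neg, abs_of_pos hε]) E hEI
    simp only [eval_sub, eval_mul, eval_C, hD2] at h1 h2
    nlinarith
  -- All perturbed discriminants now have a local maximum, of value `2`, at the same `E`; comparing
  -- `t = ε` with `t = 0` makes the derivative of `G` vanish too.
  have hder : ∀ t : ℝ, |t| ≤ ε → (derivative (discriminant V (k * p) - C t * G)).eval E = 0 := by
    intro t ht
    have hmax : IsLocalMax (fun x => (discriminant V (k * p) - C t * G).eval x) E := by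
      filter_upwards [isOpen_Ioo.mem_nhds hEI] with x hx
      refine (key t ht x hx).trans_eq ?_
      simp [hD2, hG0]
    exact hmax.hasDerivAt_eq_zero (Polynomial.hasDerivAt _ _)
  have hG1 : (derivative G).eval E = 0 := by
    have h1 := hder ε (by rw [abs_of_pos hε])
    have h2 := hder 0 (by simpa using hε.le)
    simp only [derivative_sub, derivative_mul, derivative_C, eval_sub, eval_mul, eval_C,
      zero_mul, zero_add, map_zero, sub_zero] at h1 h2
    rw [h2, zero_sub, neg_eq_zero] at h1
    exact (mul_eq_zero.1 h1).resolve_left hε.ne'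
  obtain ⟨i, hi⟩ := Nat.exists_eq_add_of_le' hq2
  have hw := dirichletPoly_wronskian V 0 E i
  rw [← hi, ← hG, hG0, hG1] at hw
  linarith

end Periodic

/-! ### Commutator estimates with slowly varying cutoffs. -/

section Localization

theorem EllTwo.mulOp_apply (V : ℤ →ᵇ ℝ) (u : EllTwo) (n : ℤ) :
    (EllTwo.mulOp V u : ℤ → ℂ) n = (V n : ℂ) * u n := rfl

theorem EllTwo.translate_apply (k : ℤ) (u : EllTwo) (n : ℤ) :
    (EllTwo.translate k u : ℤ → ℂ) n = u (n + k) := rfl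

theorem norm_mulOp_le (V : ℤ →ᵇ ℝ) : ‖EllTwo.mulOp V‖ ≤ ‖V‖ :=
  LinearMap.mkContinuous_norm_le _ (norm_nonneg _) _

theorem norm_mulOp_apply_le {V : ℤ →ᵇ ℝ} {c : ℝ} (hc : 0 ≤ c) (h : ∀ n, |V n| ≤ c) (u : EllTwo) :
    ‖EllTwo.mulOp V u‖ ≤ c * ‖u‖ :=
  (EllTwo.mulOp V).le_of_opNorm_le
    ((norm_mulOp_le V).trans ((BoundedContinuousFunction.norm_le hc).2 h)) u

theorem norm_schrodingerOp_le (V : ℤ →ᵇ ℝ) : ‖schrodingerOp V‖ ≤ 2 + ‖V‖ := by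
  have h1 := norm_add_le ((EllTwo.translate (-1)).toContinuousLinearMap +
    (EllTwo.translate 1).toContinuousLinearMap) (EllTwo.mulOp V)
  have h2 := norm_add_le (EllTwo.translate (-1)).toContinuousLinearMap
    (EllTwo.translate 1).toContinuousLinearMap
  have h3 := (EllTwo.translate 1).norm_toContinuousLinearMap_le
  have h4 := (EllTwo.translate (-1)).norm_toContinuousLinearMap_le
  have h5 := norm_mulOp_le V
  rw [schrodingerOp]
  linarith

theorem mulOp_isSelfAdjoint (V : ℤ →ᵇ ℝ) : IsSelfAdjoint (EllTwo.mulOp V) := by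
  rw [ContinuousLinearMap.isSelfAdjoint_iff_isSymmetric]
  intro u v
  simp only [ContinuousLinearMap.coe_coe, lp.inner_eq_tsum]
  refine tsum_congr fun n => ?_
  simp only [EllTwo.mulOp_apply, RCLike.inner_apply, map_mul, Complex.conj_ofReal]
  ring

/-- The difference `n ↦ φ (n + k) - φ n`. -/
noncomputable def shiftDiff (k : ℤ) (φ : ℤ →ᵇ ℝ) : ℤ →ᵇ ℝ :=
  φ.compContinuous ⟨fun n => n + k, continuous_of_discreteTopology⟩ - φ

theorem shiftDiff_apply (k : ℤ) (φ : ℤ →ᵇ ℝ) (n : ℤ) : shiftDiff k φ n = φ (n + k) - φ n := rfl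

theorem schrodingerOp_mulOp {W W' φ : ℤ →ᵇ ℝ} (h : ∀ n, φ n ≠ 0 → W n = W' n) (E : ℂ)
    (u : EllTwo) :
    schrodingerOp W' (EllTwo.mulOp φ u) - E • EllTwo.mulOp φ u =
      EllTwo.mulOp φ (schrodingerOp W u - E • u) +
        (EllTwo.mulOp (shiftDiff (-1) φ) (EllTwo.translate (-1) u) +
          EllTwo.mulOp (shiftDiff 1 φ) (EllTwo.translate 1 u)) := by
  ext n
  simp only [lp.coeFn_sub, lp.coeFn_add, lp.coeFn_smul, Pi.sub_apply, Pi.add_apply, Pi.smul_apply,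
    schrodingerOp_apply, EllTwo.mulOp_apply, EllTwo.translate_apply, shiftDiff_apply, smul_eq_mul]
  push_cast
  rw [← sub_eq_add_neg]
  by_cases hn : φ n = 0
  · rw [hn]; push_cast; ring
  · rw [h n hn]; ring

/-- The commutator with `φ²` is, up to a term quadratic in the slope, the slope times `φ u`. Since
`φ u` is itself of the order of the slope, this upgrades a first-order bound to second order; first
order would not suffice for the measure estimate. -/
theorem mulOp_shiftDiff_sq (k : ℤ) (φ : ℤ →ᵇ ℝ) (u : EllTwo) :
    EllTwo.mulOp (shiftDiff k (φ * φ)) (EllTwo.translate k u) =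
      (2 : ℂ) • EllTwo.mulOp (shiftDiff k φ) (EllTwo.translate k (EllTwo.mulOp φ u)) -
        EllTwo.mulOp (shiftDiff k φ) (EllTwo.mulOp (shiftDiff k φ) (EllTwo.translate k u)) := by
  ext n
  simp only [lp.coeFn_sub, lp.coeFn_smul, Pi.sub_apply, Pi.smul_apply,
    EllTwo.mulOp_apply, EllTwo.translate_apply, shiftDiff_apply, smul_eq_mul,
    BoundedContinuousFunction.mul_apply]
  push_cast
  ring

/-- Approximate eigenfunctions of `W` at an energy in a gap of `W'` are small deep inside the region
where the two potentials agree. -/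
theorem norm_mulOp_sq_le {W W' φ : ℤ →ᵇ ℝ} (h : ∀ n, φ n ≠ 0 → W n = W' n) {d δ E : ℝ}
    (hd : 0 < d) (hd1 : d ≤ 1) (hφ1 : ∀ n, |φ n| ≤ 1) (hφd : ∀ n, |φ (n + 1) - φ n| ≤ d)
    (hδ : 0 < δ) (hgap : ∀ u, δ * ‖u‖ ≤ ‖schrodingerOp W' u - (E : ℂ) • u‖) {u : EllTwo}
    (hu : ‖schrodingerOp W u - (E : ℂ) • u‖ ≤ d ^ 2 * ‖u‖) :
    ‖EllTwo.mulOp (φ * φ) u‖ ≤ (3 / δ + 12 / δ ^ 2) * d ^ 2 * ‖u‖ := by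
  have hs : ∀ k : ℤ, k = 1 ∨ k = -1 → ∀ v : EllTwo,
      ‖EllTwo.mulOp (shiftDiff k φ) v‖ ≤ d * ‖v‖ := by
    rintro k (rfl | rfl) v
    · exact norm_mulOp_apply_le hd.le hφd v
    · refine norm_mulOp_apply_le hd.le (fun n => ?_) v
      rw [shiftDiff_apply, abs_sub_comm]
      simpa using hφd (n + -1)
  have ht : ∀ (k : ℤ) (v : EllTwo), ‖EllTwo.translate k v‖ = ‖v‖ := fun k v =>
    (EllTwo.translate k).norm_map v
  have hs2 : ∀ k : ℤ, k = 1 ∨ k = -1 →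
      ‖EllTwo.mulOp (shiftDiff k (φ * φ)) (EllTwo.translate k u)‖ ≤
        2 * d * ‖EllTwo.mulOp φ u‖ + d ^ 2 * ‖u‖ := by
    intro k hk
    rw [mulOp_shiftDiff_sq]
    refine (norm_sub_le _ _).trans (add_le_add ?_ ?_)
    · rw [norm_smul]
      have := hs k hk (EllTwo.translate k (EllTwo.mulOp φ u))
      rw [ht] at this
      norm_num
      linarith
    · refine (hs k hk _).trans ?_
      have := hs k hk (EllTwo.translate k u)
      rw [ht] at this
      nlinarith
  -- First pass: the gap turns the commutator bound into `φ u = O(d)`.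
  have h1 : δ * ‖EllTwo.mulOp φ u‖ ≤ 3 * d * ‖u‖ := by
    refine (hgap _).trans ?_
    rw [schrodingerOp_mulOp h]
    have a1 := norm_mulOp_apply_le zero_le_one hφ1 (schrodingerOp W u - (E : ℂ) • u)
    have a2 := hs (-1) (Or.inr rfl) (EllTwo.translate (-1) u)
    have a3 := hs 1 (Or.inl rfl) (EllTwo.translate 1 u)
    rw [ht] at a2 a3
    have a4 : d ^ 2 * ‖u‖ ≤ d * ‖u‖ := by
      refine mul_le_mul_of_nonneg_right ?_ (norm_nonneg _)
      nlinarith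
    refine (norm_add_le _ _).trans ?_
    have a5 := norm_add_le (EllTwo.mulOp (shiftDiff (-1) φ) (EllTwo.translate (-1) u))
      (EllTwo.mulOp (shiftDiff 1 φ) (EllTwo.translate 1 u))
    linarith
  -- Second pass, with cutoff `φ²`: the commutator is now `O(d²)` once the first bound is inserted.
  have h2 : δ * ‖EllTwo.mulOp (φ * φ) u‖ ≤ 4 * d * ‖EllTwo.mulOp φ u‖ + 3 * d ^ 2 * ‖u‖ := by
    refine (hgap _).trans ?_
    rw [schrodingerOp_mulOp (W := W) (fun n hn => h n (by
      rw [BoundedContinuousFunction.mul_apply] at hn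
      exact left_ne_zero_of_mul hn))]
    have a1 := norm_mulOp_apply_le (V := φ * φ) zero_le_one (fun n => by
      rw [BoundedContinuousFunction.mul_apply, abs_mul]
      exact mul_le_one₀ (hφ1 n) (abs_nonneg _) (hφ1 n)) (schrodingerOp W u - (E : ℂ) • u)
    have a2 := hs2 (-1) (Or.inr rfl)
    have a3 := hs2 1 (Or.inl rfl)
    refine (norm_add_le _ _).trans ?_
    have a5 := norm_add_le (EllTwo.mulOp (shiftDiff (-1) (φ * φ)) (EllTwo.translate (-1) u))
      (EllTwo.mulOp (shiftDiff 1 (φ * φ)) (EllTwo.translate 1 u))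
    linarith
  have h3 : ‖EllTwo.mulOp φ u‖ ≤ 3 * d * ‖u‖ / δ := by
    rw [le_div_iff₀ hδ]; linarith
  have h4 : δ * ‖EllTwo.mulOp (φ * φ) u‖ ≤ 4 * d * (3 * d * ‖u‖ / δ) + 3 * d ^ 2 * ‖u‖ :=
    h2.trans (by gcongr)
  rw [← le_div_iff₀' hδ] at h4
  refine h4.trans_eq ?_
  field_simp
  ring

end Localization

/-! ### The operator cut along an arithmetic progression of sites. -/

section Decoupling

open Polynomial

/-- The indicator of the complement of `c + Nℤ`. -/
noncomputable def cutMask (N : ℕ) (c : ℤ) : ℤ →ᵇ ℝ :=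
  BoundedContinuousFunction.ofNormedAddCommGroupDiscrete
    (fun n => if (N : ℤ) ∣ n - c then 0 else 1) 1 (fun n => by split_ifs <;> simp)

theorem cutMask_apply (N : ℕ) (c n : ℤ) :
    cutMask N c n = if (N : ℤ) ∣ n - c then 0 else 1 := rfl

/-- The Schrödinger operator with all couplings to the sites of `c + Nℤ` removed. -/
noncomputable def decoupledOp (W : ℤ →ᵇ ℝ) (N : ℕ) (c : ℤ) : EllTwo →L[ℂ] EllTwo :=
  EllTwo.mulOp (cutMask N c) * schrodingerOp W * EllTwo.mulOp (cutMask N c)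

theorem decoupledOp_isSelfAdjoint (W : ℤ →ᵇ ℝ) (N : ℕ) (c : ℤ) :
    IsSelfAdjoint (decoupledOp W N c) :=
  (schrodingerOp_isSelfAdjoint W).conjugate_self (mulOp_isSelfAdjoint _)

/-- The first site after a cut is cyclic for its block: the entry at distance `j` is read off there
after applying the `j`-th Dirichlet polynomial. At `j = N` the next cut makes the left side vanish.
-/
theorem mask_apply_eq_dirichletPoly {W : ℤ →ᵇ ℝ} {N : ℕ} (hW : ∀ n, W (n + N) = W n) {c s : ℤ}
    (hs : (N : ℤ) ∣ s - c) (j : ℕ) (hj : j ≤ N) (u : EllTwo) :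
    (cutMask N c (s + j) : ℂ) * u (s + j) = cutMask N c (s + 1) *
      (aeval (decoupledOp W N c) (dirichletPoly W c j) u : ℤ → ℂ) (s + 1) := by
  induction j using Nat.twoStepInduction generalizing u with
  | zero => simp [cutMask_apply, hs, dirichletPoly]
  | one => simp [dirichletPoly]
  | more j ih1 ih2 =>
    have hWs : W (c + (j + 1 : ℕ)) = W (s + (j + 1 : ℕ)) := by
      obtain ⟨k, hk⟩ := hs
      rw [← (Function.Periodic.int_mul hW k) (c + (j + 1 : ℕ))]
      congr 1
      simp only [Int.cast_id]
      linarith [mul_comm (N : ℤ) k]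
    have hmask : cutMask N c (s + (j + 1 : ℕ)) = 1 := by
      rw [cutMask_apply, if_neg]
      intro hd
      have h1 : (N : ℤ) ∣ ((j + 1 : ℕ) : ℤ) := by
        have := dvd_sub hd hs
        ring_nf at this ⊢
        exact this
      have := Int.le_of_dvd (by omega) h1
      omega
    have h1 := ih2 (by omega) (decoupledOp W N c u)
    have h2 := ih2 (by omega) u
    have h3 := ih1 (by omega) u
    have h4 : (decoupledOp W N c u : ℤ → ℂ) (s + (j + 1 : ℕ)) =
        cutMask N c (s + j) * u (s + j) + cutMask N c (s + (j + 2 : ℕ)) * u (s + (j + 2 : ℕ)) +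
          W (s + (j + 1 : ℕ)) * u (s + (j + 1 : ℕ)) := by
      change (cutMask N c (s + (j + 1 : ℕ)) : ℂ) *
        (schrodingerOp W (EllTwo.mulOp (cutMask N c) u) : ℤ → ℂ) (s + (j + 1 : ℕ)) = _
      have e1 : s + ((j + 1 : ℕ) : ℤ) - 1 = s + j := by push_cast; ring
      have e2 : s + ((j + 1 : ℕ) : ℤ) + 1 = s + (j + 2 : ℕ) := by push_cast; ring
      rw [schrodingerOp_apply, EllTwo.mulOp_apply, EllTwo.mulOp_apply, EllTwo.mulOp_apply, hmask,
        e1, e2]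
      push_cast
      ring
    rw [dirichletPoly, aeval_sub_apply, aeval_X_sub_C_mul_apply, hWs]
    rw [h4, hmask] at h1
    rw [hmask] at h2
    push_cast at h1 h2 h3 ⊢
    linear_combination h1 - (W (s + (j + 1)) : ℂ) * h2 - h3

/-- By periodicity all blocks share the same Dirichlet polynomial, which annihilates each of them;
the factor `X` handles the cut sites, where the operator is zero. -/
theorem aeval_decoupledOp {W : ℤ →ᵇ ℝ} {N : ℕ} (hN : 0 < N) (hW : ∀ n, W (n + N) = W n) (c : ℤ) :
    aeval (decoupledOp W N c) (X * dirichletPoly W c N) = 0 := by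
  set K := decoupledOp W N c with hK
  have h0 : ∀ (s : ℤ), (N : ℤ) ∣ s - c → ∀ u : EllTwo, (cutMask N c (s + 1) : ℂ) *
      (aeval K (dirichletPoly W c N) u : ℤ → ℂ) (s + 1) = 0 := by
    intro s hs u
    rw [← mask_apply_eq_dirichletPoly hW hs N le_rfl u, cutMask_apply, if_pos]
    · simp
    · rw [add_sub_right_comm]
      exact dvd_add hs dvd_rfl
  have h1 : ∀ u, EllTwo.mulOp (cutMask N c) (aeval K (dirichletPoly W c N) u) = 0 := by
    intro u
    ext n
    have hn : n = n - (n - c) % N + ((n - c) % N).toNat := by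
      rw [Int.toNat_of_nonneg (Int.emod_nonneg _ (by omega))]; ring
    have hs : (N : ℤ) ∣ n - (n - c) % N - c := by
      have := Int.dvd_self_sub_emod (x := n - c) (m := N)
      convert this using 1
      ring
    have hlt := Int.emod_lt_of_pos (n - c) (b := (N : ℤ)) (by omega)
    rw [EllTwo.mulOp_apply, hn, mask_apply_eq_dirichletPoly hW hs _ (by omega)]
    have hcomm : aeval K (dirichletPoly W c ((n - c) % N).toNat)
        (aeval K (dirichletPoly W c N) u) = aeval K (dirichletPoly W c N)
          (aeval K (dirichletPoly W c ((n - c) % N).toNat) u) := by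
      rw [← mul_apply_eq_comp, ← map_mul, mul_comm, map_mul, mul_apply_eq_comp]
    rw [hcomm, h0 _ hs]
    rfl
  ext1 u
  rw [map_mul, aeval_X]
  change EllTwo.mulOp (cutMask N c) (schrodingerOp W (EllTwo.mulOp (cutMask N c)
    (aeval K (dirichletPoly W c N) u))) = 0
  rw [h1, map_zero, map_zero]

end Decoupling

/-! ### Covering part of the spectrum by few short intervals. -/

section BandMeasure

open Polynomial

/-- The tent function of height `1` and slope `1 / R` around `c + Nℤ`. -/
noncomputable def tent (N : ℕ) (c : ℤ) (R : ℝ) : ℤ →ᵇ ℝ :=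
  BoundedContinuousFunction.ofNormedAddCommGroupDiscrete
    (fun n => max 0 (1 - |Metric.infDist n {s : ℤ | (N : ℤ) ∣ s - c} / R|)) 1 (fun n => by
      rw [Real.norm_eq_abs, abs_of_nonneg (le_max_left _ _)]
      exact max_le zero_le_one (sub_le_self _ (abs_nonneg _)))

theorem tent_apply (N : ℕ) (c : ℤ) (R : ℝ) (n : ℤ) : tent N c R n =
    max 0 (1 - |Metric.infDist n {s : ℤ | (N : ℤ) ∣ s - c} / R|) := rfl

theorem abs_tent_le (N : ℕ) (c : ℤ) (R : ℝ) (n : ℤ) : |tent N c R n| ≤ 1 := by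
  rw [tent_apply, abs_of_nonneg (le_max_left _ _)]
  exact max_le zero_le_one (sub_le_self _ (abs_nonneg _))

theorem abs_tent_succ_sub_le (N : ℕ) (c : ℤ) {R : ℝ} (hR : 0 < R) (n : ℤ) :
    |tent N c R (n + 1) - tent N c R n| ≤ 1 / R := by
  rw [tent_apply, tent_apply]
  have h := (Metric.lipschitz_infDist_pt {s : ℤ | (N : ℤ) ∣ s - c}).dist_le_mul (n + 1) n
  simp only [NNReal.coe_one, one_mul, Int.dist_eq, Real.dist_eq] at h
  push_cast at h
  rw [add_sub_cancel_left, abs_one] at h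
  rw [max_comm 0, max_comm 0]
  refine (abs_max_sub_max_le_abs _ _ _).trans ?_
  rw [sub_sub_sub_cancel_left]
  refine (abs_abs_sub_abs_le _ _).trans ?_
  rw [← sub_div, abs_div, abs_of_pos hR, abs_sub_comm]
  gcongr

theorem tent_eq_one {N : ℕ} {c : ℤ} (R : ℝ) {n : ℤ} (hn : (N : ℤ) ∣ n - c) : tent N c R n = 1 := by
  rw [tent_apply, Metric.infDist_zero_of_mem (s := {s : ℤ | (N : ℤ) ∣ s - c}) hn]
  simp

theorem exists_dist_lt_of_tent_ne_zero {N : ℕ} {c : ℤ} {R : ℝ} (hR0 : 0 < R) {n : ℤ}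
    (hn : tent N c R n ≠ 0) : ∃ s : ℤ, (N : ℤ) ∣ s - c ∧ |(n : ℝ) - s| < R := by
  by_contra! hcon
  refine hn ?_
  rw [tent_apply]
  apply max_eq_left
  have hne : {s : ℤ | (N : ℤ) ∣ s - c}.Nonempty := ⟨c, by simp⟩
  have : R ≤ Metric.infDist n {s : ℤ | (N : ℤ) ∣ s - c} :=
    (Metric.le_infDist hne).2 fun s hs => by rw [Int.dist_eq]; exact hcon s hs
  rw [abs_of_nonneg (div_nonneg Metric.infDist_nonneg hR0.le), sub_nonpos, le_div_iff₀ hR0]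
  linarith

/-- Because `W` agrees with the gapped `W'` near the cuts, an approximate eigenvector almost
vanishes there. Deleting its cut values leaves an approximate eigenvector of the decoupled operator,
whose spectrum lies in the root set. -/
theorem exists_root_near {W W' : ℤ →ᵇ ℝ} {N : ℕ} (hN : 0 < N) (hW : ∀ n, W (n + N) = W n) {c : ℤ}
    {R : ℝ} (hR : 1 ≤ R) (hWW' : ∀ n s : ℤ, (N : ℤ) ∣ s - c → |(n : ℝ) - s| < R → W n = W' n)
    {δ E : ℝ} (hδ : 0 < δ) (hgap : ∀ u, δ * ‖u‖ ≤ ‖schrodingerOp W' u - (E : ℂ) • u‖)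
    (hsmall : (3 / δ + 12 / δ ^ 2) / R ^ 2 ≤ 1 / 2)
    (hE : E ∈ spectrum ℝ (schrodingerOp W)) :
    ∃ x : ℝ, (X * dirichletPoly W c N).IsRoot x ∧
      |x - E| < (3 + 2 * (2 + ‖W‖) * (3 / δ + 12 / δ ^ 2)) / R ^ 2 := by
  have hR0 : 0 < R := by linarith
  set d := 1 / R with hd
  have hd0 : 0 < d := by positivity
  have hd1 : d ≤ 1 := by rw [hd, div_le_one hR0]; exact hR
  set A := 3 / δ + 12 / δ ^ 2 with hA
  have hA0 : 0 < A := by positivity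
  have hdR : ∀ y : ℝ, y / R ^ 2 = y * d ^ 2 := fun y => by rw [hd]; field_simp
  rw [hdR] at hsmall ⊢
  obtain ⟨u, hu0, hu⟩ := exists_approx_eigenvector (schrodingerOp_isSelfAdjoint W) hE
    (ε := d ^ 2) (by positivity)
  have hu' := norm_pos_iff.2 hu0
  have h1 : ‖EllTwo.mulOp (tent N c R * tent N c R) u‖ ≤ A * d ^ 2 * ‖u‖ :=
    norm_mulOp_sq_le (W := W) (W' := W') (fun n hn => by
      obtain ⟨s, hs, hns⟩ := exists_dist_lt_of_tent_ne_zero hR0 hn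
      exact hWW' n s hs hns) hd0 hd1 (abs_tent_le N c R) (abs_tent_succ_sub_le N c hR0) hδ hgap hu
  set Q := EllTwo.mulOp (cutMask N c) with hQ
  have h2 : ‖u - Q u‖ ≤ A * d ^ 2 * ‖u‖ := by
    refine le_trans (lp.norm_mono (by norm_num) fun n => ?_) h1
    rw [lp.coeFn_sub, Pi.sub_apply, hQ, EllTwo.mulOp_apply, EllTwo.mulOp_apply, cutMask_apply,
      BoundedContinuousFunction.mul_apply]
    split_ifs with h
    · simp [tent_eq_one R h]
    · simp only [Complex.ofReal_one, one_mul, sub_self, norm_zero]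
      positivity
  have hQQ : Q (Q u) = Q u := by
    ext n
    rw [hQ, EllTwo.mulOp_apply, EllTwo.mulOp_apply, cutMask_apply]
    split_ifs <;> simp
  have hQn : ∀ v, ‖Q v‖ ≤ ‖v‖ := fun v => by
    have := norm_mulOp_apply_le (V := cutMask N c) zero_le_one
      (fun n => by rw [cutMask_apply]; split_ifs <;> simp) v
    rwa [one_mul] at this
  have h3 : ‖decoupledOp W N c (Q u) - (E : ℂ) • Q u‖ ≤
      d ^ 2 * ‖u‖ + (2 + ‖W‖) * (A * d ^ 2 * ‖u‖) := by
    have e : decoupledOp W N c (Q u) - (E : ℂ) • Q u =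
        Q (schrodingerOp W u - (E : ℂ) • u) - Q (schrodingerOp W (u - Q u)) := by
      have : decoupledOp W N c (Q u) = Q (schrodingerOp W (Q (Q u))) := rfl
      rw [this, hQQ]
      simp only [map_sub, map_smul]
      abel
    rw [e]
    refine (norm_sub_le _ _).trans (add_le_add ((hQn _).trans hu) ((hQn _).trans ?_))
    refine ((schrodingerOp W).le_of_opNorm_le (norm_schrodingerOp_le W) _).trans ?_
    gcongr
  have h4 : ‖u‖ / 2 ≤ ‖Q u‖ := by
    have := norm_sub_norm_le u (Q u)
    nlinarith
  have hQu : Q u ≠ 0 := by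
    rw [← norm_pos_iff]; linarith
  -- The factor `2` pays for `‖Q u‖ ≥ ‖u‖ / 2`; the constant `3` instead of `2` makes the inequality
  -- strict.
  obtain ⟨x, hx, hxE⟩ := exists_mem_spectrum_abs_sub_le (decoupledOp_isSelfAdjoint W N c) hQu
    (η := (3 + 2 * (2 + ‖W‖) * A) * d ^ 2) (by
      refine h3.trans_lt ?_
      have hW0 := norm_nonneg W
      calc d ^ 2 * ‖u‖ + (2 + ‖W‖) * (A * d ^ 2 * ‖u‖)
          < (3 + 2 * (2 + ‖W‖) * A) * d ^ 2 * (‖u‖ / 2) := by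
            have : 0 < d ^ 2 * ‖u‖ := by positivity
            linarith
        _ ≤ _ := by gcongr)
  refine ⟨x, ?_, hxE⟩
  have h5 : (X * dirichletPoly W c N).eval x ∈
      spectrum ℝ (aeval (decoupledOp W N c) (X * dirichletPoly W c N)) :=
    spectrum.subset_polynomial_aeval _ _ ⟨x, hx, rfl⟩
  have : Nontrivial (EllTwo →L[ℂ] EllTwo) := by
    refine ⟨⟨1, 0, fun h => hu0 ?_⟩⟩
    simpa using congrArg (fun T : EllTwo →L[ℂ] EllTwo => T u) h
  rw [aeval_decoupledOp hN hW c, spectrum.zero_eq] at h5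
  exact h5

theorem volume_spectrum_inter_le {W W' : ℤ →ᵇ ℝ} {N : ℕ} (hN : 2 ≤ N) (hW : ∀ n, W (n + N) = W n)
    {c : ℤ} {R : ℝ} (hR : 1 ≤ R)
    (hWW' : ∀ n s : ℤ, (N : ℤ) ∣ s - c → |(n : ℝ) - s| < R → W n = W' n)
    {δ : ℝ} {J : Set ℝ} (hδ : 0 < δ)
    (hgap : ∀ E ∈ J, ∀ u, δ * ‖u‖ ≤ ‖schrodingerOp W' u - (E : ℂ) • u‖)
    (hsmall : (3 / δ + 12 / δ ^ 2) / R ^ 2 ≤ 1 / 2) :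
    volume (spectrum ℝ (schrodingerOp W) ∩ J) ≤
      ENNReal.ofReal (N * (2 * ((3 + 2 * (2 + ‖W‖) * (3 / δ + 12 / δ ^ 2)) / R ^ 2))) := by
  set η := (3 + 2 * (2 + ‖W‖) * (3 / δ + 12 / δ ^ 2)) / R ^ 2 with hη
  have hη0 : 0 ≤ η := by positivity
  set P := X * dirichletPoly W c N with hP
  have hP0 : P ≠ 0 := mul_ne_zero X_ne_zero (dirichletPoly_ne_zero W c hN)
  have hdeg : P.natDegree ≤ N := by
    refine natDegree_mul_le.trans ?_
    have := natDegree_dirichletPoly_le W c N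
    rw [natDegree_X]
    omega
  have hsub : spectrum ℝ (schrodingerOp W) ∩ J ⊆ ⋃ x ∈ P.roots.toFinset, Metric.ball x η := by
    rintro E ⟨hE, hEJ⟩
    obtain ⟨x, hx, hxE⟩ := exists_root_near (by omega) hW hR hWW' hδ (hgap E hEJ) hsmall hE
    refine Set.mem_biUnion (x := x) ?_ ?_
    · rw [Finset.mem_coe, Multiset.mem_toFinset, mem_roots hP0]
      exact hx
    · rw [Metric.mem_ball, Real.dist_eq, abs_sub_comm]
      exact hxE
  calc volume (spectrum ℝ (schrodingerOp W) ∩ J)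
      ≤ volume (⋃ x ∈ P.roots.toFinset, Metric.ball x η) := measure_mono hsub
    _ ≤ ∑ x ∈ P.roots.toFinset, volume (Metric.ball x η) := measure_biUnion_finset_le _ _
    _ = P.roots.toFinset.card * ENNReal.ofReal (2 * η) := by
      simp [Real.volume_ball]
    _ ≤ (N : ENNReal) * ENNReal.ofReal (2 * η) := by
      gcongr
      exact (Multiset.toFinset_card_le _).trans ((card_roots' P).trans hdeg)
    _ = ENNReal.ofReal (N * (2 * η)) := by
      rw [ENNReal.ofReal_mul (Nat.cast_nonneg N), ENNReal.ofReal_natCast]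

end BandMeasure

/-! ### Open subgroups, periods and periodic sampling functions. -/

section Periods

open Topology

variable {Ω : Type*} [AddCommGroup Ω] [TopologicalSpace Ω]

theorem norm_sub_le_of_dense [CompactSpace Ω] {α : Ω} (hα : Dense (Set.range fun n : ℤ => n • α))
    {f g : C(Ω, ℝ)} {ε : ℝ} (hε : 0 ≤ ε) (h : ∀ n : ℤ, |f (n • α) - g (n • α)| ≤ ε) : ‖f - g‖ ≤ ε := by
  rw [ContinuousMap.norm_le _ hε]
  have hcl : IsClosed {x | ‖(f - g) x‖ ≤ ε} :=
    isClosed_le (f - g).continuous.norm continuous_const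
  intro x
  have : closure (Set.range fun n : ℤ => n • α) ⊆ {x | ‖(f - g) x‖ ≤ ε} :=
    hcl.closure_subset_iff.2 (by rintro _ ⟨n, rfl⟩; exact h n)
  exact this (hα x)

theorem zsmul_ne_zero_of_dense [T1Space Ω] [PerfectSpace Ω] {α : Ω}
    (hα : Dense (Set.range fun n : ℤ => n • α)) {k : ℤ} (hk : k ≠ 0) : k • α ≠ 0 := by
  intro h0
  have hfin : (Set.range fun n : ℤ => n • α).Finite := by
    refine ((Set.finite_Icc (0 : ℤ) |k|).image fun n => n • α).subset ?_
    rintro _ ⟨n, rfl⟩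
    refine ⟨n % k, ⟨Int.emod_nonneg _ hk, (Int.emod_lt_abs n hk).le⟩, ?_⟩
    have : n • α = (n % k + k * (n / k)) • α := by rw [Int.emod_add_mul_ediv]
    simp only
    rw [this, add_zsmul, mul_comm, mul_zsmul, h0, zsmul_zero, add_zero]
  have huniv : (Set.univ : Set Ω).Finite := by
    rw [← hα.closure_eq, hfin.isClosed.closure_eq]
    exact hfin
  have hacc := PerfectSpace.univ_preperfect (α := Ω) 0 (Set.mem_univ _)
  rw [accPt_iff_nhds] at hacc
  have hopen : IsOpen ({0} : Set Ω) := by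
    have : ((Set.univ : Set Ω) \ {0}).Finite := huniv.subset Set.sdiff_subset
    rw [← isClosed_compl_iff, Set.compl_eq_univ_sdiff]
    exact this.isClosed
  obtain ⟨y, hy, hy0⟩ := hacc _ (hopen.mem_nhds rfl)
  exact hy0 hy.1

variable [IsTopologicalAddGroup Ω]

/-- `q` is a period of `α` modulo some open subgroup. -/
def IsAdmissiblePeriod (α : Ω) (q : ℕ) : Prop :=
  0 < q ∧ ∃ U : OpenAddSubgroup Ω, ∀ n : ℤ, n • α ∈ U ↔ (q : ℤ) ∣ n

/-- Each coset of `U` contains some `n • α`, with `n` unique modulo `q`; so `V` descends to a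
locally constant function on `Ω`. -/
theorem IsAdmissiblePeriod.exists_extension {α : Ω} (hα : Dense (Set.range fun n : ℤ => n • α))
    {q : ℕ} (hq : IsAdmissiblePeriod α q) {V : ℤ → ℝ} (hV : ∀ n, V (n + q) = V n) :
    ∃ f : C(Ω, ℝ), ∀ n : ℤ, f (n • α) = V n := by
  obtain ⟨_, U, hU⟩ := hq
  have hex : ∀ x : Ω, ∃ n : ℤ, n • α - x ∈ U := by
    intro x
    have hopen : IsOpen ((fun y => y - x) ⁻¹' (U : Set Ω)) :=
      U.isOpen.preimage (continuous_sub_right x)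
    obtain ⟨_, hy, n, rfl⟩ := hα.inter_open_nonempty _ hopen ⟨x, by simp⟩
    exact ⟨n, hy⟩
  choose N hN using hex
  have hVeq : ∀ n m : ℤ, n • α - m • α ∈ U → V n = V m := by
    intro n m h
    rw [← sub_smul, hU] at h
    obtain ⟨k, hk⟩ := h
    rw [← (Function.Periodic.int_mul hV k) m]
    congr 1
    simp only [Int.cast_id]
    linarith [mul_comm (q : ℤ) k]
  have hloc : IsLocallyConstant fun x => V (N x) := by
    rw [IsLocallyConstant.iff_eventually_eq]
    intro x
    have hopen : IsOpen ((fun y => y - x) ⁻¹' (U : Set Ω)) :=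
      U.isOpen.preimage (continuous_sub_right x)
    filter_upwards [hopen.mem_nhds (by simp)] with y hy
    refine hVeq _ _ ?_
    have := sub_mem (add_mem (hN y) hy) (hN x)
    have e : N y • α - y + (y - x) - (N x • α - x) = N y • α - N x • α := by abel
    exact e ▸ this
  exact ⟨⟨_, hloc.continuous⟩, fun n => hVeq _ _ (hN (n • α))⟩

variable [CompactSpace Ω]

theorem exists_period_of_openAddSubgroup (α : Ω) (U : OpenAddSubgroup Ω) :
    ∃ q : ℕ, 0 < q ∧ ∀ n : ℤ, n • α ∈ U ↔ (q : ℤ) ∣ n := by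
  refine ⟨addOrderOf (QuotientAddGroup.mk α : Ω ⧸ U.toAddSubgroup), addOrderOf_pos _, fun n => ?_⟩
  rw [addOrderOf_dvd_iff_zsmul_eq_zero, ← QuotientAddGroup.mk_zsmul,
    QuotientAddGroup.eq_zero_iff]
  rfl

theorem IsAdmissiblePeriod.exists_common {α : Ω} {q r : ℕ} (hq : IsAdmissiblePeriod α q)
    (hr : IsAdmissiblePeriod α r) : ∃ s, IsAdmissiblePeriod α s ∧ q ∣ s ∧ r ∣ s := by
  obtain ⟨_, U, hU⟩ := hq
  obtain ⟨_, U', hU'⟩ := hr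
  obtain ⟨s, hs, h⟩ := exists_period_of_openAddSubgroup α (U ⊓ U')
  have hs' : (s : ℤ) • α ∈ U ⊓ U' := (h s).2 dvd_rfl
  rw [OpenAddSubgroup.mem_inf, hU, hU'] at hs'
  exact ⟨s, ⟨hs, _, h⟩, Int.natCast_dvd_natCast.1 hs'.1, Int.natCast_dvd_natCast.1 hs'.2⟩

theorem exists_common_admissiblePeriod {α : Ω} {q : ℕ} (hq : IsAdmissiblePeriod α q) {ι : Type*}
    (t : Finset ι) {r : ι → ℕ} (hr : ∀ i ∈ t, IsAdmissiblePeriod α (r i)) :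
    ∃ s, IsAdmissiblePeriod α s ∧ q ∣ s ∧ ∀ i ∈ t, r i ∣ s := by
  classical
  induction t using Finset.induction_on with
  | empty => exact ⟨q, hq, dvd_rfl, by simp⟩
  | insert i t _ ih =>
    obtain ⟨s, hs, hqs, hts⟩ := ih fun j hj => hr j (Finset.mem_insert_of_mem hj)
    obtain ⟨s', hs', h1, h2⟩ := hs.exists_common (hr i (Finset.mem_insert_self _ _))
    refine ⟨s', hs', hqs.trans h1, fun j hj => ?_⟩
    rcases Finset.mem_insert.1 hj with rfl | hj
    · exact h2
    · exact (hts j hj).trans h1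

/-- Uniform continuity: the translates of `f` are close to `f` for small translations. -/
theorem eventually_forall_abs_sub_lt (f : C(Ω, ℝ)) {ε : ℝ} (hε : 0 < ε) :
    ∀ᶠ v in 𝓝 (0 : Ω), ∀ x, |f (x + v) - f x| < ε := by
  set F : C(Ω, C(Ω, ℝ)) :=
    (f.comp ⟨fun p : Ω × Ω => p.2 + p.1, continuous_snd.add continuous_fst⟩).curry
  have h := F.continuous.continuousAt (x := 0) (Metric.ball_mem_nhds (F 0) hε)
  filter_upwards [h] with v hv x
  rw [Set.mem_preimage, Metric.mem_ball, ContinuousMap.dist_lt_iff hε] at hv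
  have := hv x
  rw [Real.dist_eq] at this
  simpa [F] using this

variable [TotallyDisconnectedSpace Ω] [T2Space Ω]

theorem exists_openAddSubgroup_subset {s : Set Ω} (hs : s ∈ 𝓝 (0 : Ω)) :
    ∃ U : OpenAddSubgroup Ω, (U : Set Ω) ⊆ s := by
  obtain ⟨W, ⟨h0, hW⟩, hWs⟩ := (nhds_basis_clopen (0 : Ω)).mem_iff.1 hs
  obtain ⟨U, hU⟩ := IsTopologicalAddGroup.exist_openAddSubgroup_sub_clopen_nhds_of_zero hW h0
  exact ⟨U, hU.trans hWs⟩

theorem exists_almostPeriod (α : Ω) (f : C(Ω, ℝ)) {ε : ℝ} (hε : 0 < ε) :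
    ∃ q, IsAdmissiblePeriod α q ∧
      ∀ n k : ℤ, |f ((n + k * q) • α) - f (n • α)| < ε := by
  obtain ⟨U, hU⟩ := exists_openAddSubgroup_subset (eventually_forall_abs_sub_lt f hε)
  obtain ⟨q, hq, h⟩ := exists_period_of_openAddSubgroup α U
  refine ⟨q, ⟨hq, U, h⟩, fun n k => ?_⟩
  rw [add_zsmul]
  exact hU ((h (k * q)).2 (dvd_mul_left _ _)) (n • α)

theorem exists_periodic_approx {α : Ω} (hα : Dense (Set.range fun n : ℤ => n • α)) (f : C(Ω, ℝ))
    {ε : ℝ} (hε : 0 < ε) : ∃ q, IsAdmissiblePeriod α q ∧ ∃ g : C(Ω, ℝ), ‖g - f‖ ≤ ε ∧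
      ∀ n : ℤ, g ((n + q) • α) = g (n • α) := by
  obtain ⟨q, hq, h⟩ := exists_almostPeriod α f hε
  have hper : ∀ n : ℤ, f (((n + q) % q) • α) = f ((n % q) • α) := fun n => by
    rw [Int.add_emod_right]
  obtain ⟨g, hg⟩ := hq.exists_extension hα (V := fun n => f ((n % q) • α)) hper
  refine ⟨q, hq, g, norm_sub_le_of_dense hα hε.le fun n => ?_, fun n => ?_⟩
  · rw [hg]
    have := h n (-(n / q))
    have e : n + -(n / q) * q = n % q := by
      have := Int.emod_add_mul_ediv n q
      linarith [mul_comm (q : ℤ) (n / q)]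
    rw [e] at this
    exact this.le
  · rw [hg, hg, hper]

/-- Without isolated points `α` has infinite order, so some open subgroup avoids `α, …, M α`. -/
theorem IsAdmissiblePeriod.exists_large [PerfectSpace Ω] {α : Ω}
    (hα : Dense (Set.range fun n : ℤ => n • α)) {q : ℕ} (hq : IsAdmissiblePeriod α q) (M : ℕ) :
    ∃ s, IsAdmissiblePeriod α s ∧ q ∣ s ∧ M ≤ s := by
  have hfin : ((fun n : ℤ => n • α) '' Set.Icc 1 (M : ℤ)).Finite := (Set.finite_Icc _ _).image _
  have hmem : ((fun n : ℤ => n • α) '' Set.Icc 1 (M : ℤ))ᶜ ∈ 𝓝 (0 : Ω) := by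
    refine hfin.isClosed.isOpen_compl.mem_nhds ?_
    rintro ⟨n, hn, h0⟩
    exact zsmul_ne_zero_of_dense hα (by have := hn.1; omega) h0
  obtain ⟨U, hU⟩ := exists_openAddSubgroup_subset hmem
  obtain ⟨r, hr, h⟩ := exists_period_of_openAddSubgroup α U
  have hMr : M < r := by
    by_contra! hle
    exact hU ((h r).2 dvd_rfl) ⟨r, ⟨by omega, by omega⟩, rfl⟩
  obtain ⟨s, hs, hqs, hrs⟩ := hq.exists_common ⟨hr, U, h⟩
  exact ⟨s, hs, hqs, hMr.le.trans (Nat.le_of_dvd hs.1 hrs)⟩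

end Periods

/-! ### Moving a prescribed energy into a gap. -/

section SmallSpectrum

open Topology

theorem schrodingerOp_sub (V W : ℤ →ᵇ ℝ) :
    schrodingerOp V - schrodingerOp W = EllTwo.mulOp (V - W) := by
  ext u n
  change (u (n - 1) + u (n + 1) + (V n : ℂ) * u n) - (u (n - 1) + u (n + 1) + (W n : ℂ) * u n) =
    ((V n - W n : ℝ) : ℂ) * u n
  push_cast
  ring

theorem norm_schrodingerOp_sub_le (V W : ℤ →ᵇ ℝ) :
    ‖schrodingerOp V - schrodingerOp W‖ ≤ ‖V - W‖ := by
  rw [schrodingerOp_sub]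
  exact norm_mulOp_le _

theorem abs_le_of_mem_spectrum {V : ℤ →ᵇ ℝ} {E : ℝ} (hE : E ∈ spectrum ℝ (schrodingerOp V)) :
    |E| ≤ 2 + ‖V‖ := by
  have h1 : ‖E‖ ≤ _ := spectrum.norm_le_norm_mul_of_mem hE
  have h2 : ‖(1 : EllTwo →L[ℂ] EllTwo)‖ ≤ 1 := ContinuousLinearMap.norm_id_le
  have h3 := norm_schrodingerOp_le V
  have h4 := norm_nonneg (schrodingerOp V)
  rw [Real.norm_eq_abs] at h1
  nlinarith

theorem sub_mem_spectrum_of_const {V W : ℤ →ᵇ ℝ} {t E : ℝ} (h : ∀ n, W n = V n + t)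
    (hE : E ∈ spectrum ℝ (schrodingerOp W)) : E - t ∈ spectrum ℝ (schrodingerOp V) := by
  have e : schrodingerOp W = algebraMap ℝ (EllTwo →L[ℂ] EllTwo) t + schrodingerOp V := by
    rw [Algebra.algebraMap_eq_smul_one]
    ext u n
    change u (n - 1) + u (n + 1) + (W n : ℂ) * u n =
      t • u n + (u (n - 1) + u (n + 1) + (V n : ℂ) * u n)
    rw [h, Complex.real_smul]
    push_cast
    ring
  rwa [e, ← sub_add_cancel E t, spectrum.add_mem_add_iff] at hE

/-- Off the spectrum the operator is bounded below, uniformly for nearby energies. -/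
theorem exists_uniform_gap {V : ℤ →ᵇ ℝ} {E : ℝ} (hE : E ∉ spectrum ℝ (schrodingerOp V)) :
    ∃ δ > 0, ∀ E' ∈ Metric.ball E δ, ∀ u : EllTwo,
      δ * ‖u‖ ≤ ‖schrodingerOp V u - (E' : ℂ) • u‖ := by
  have hcl : IsClosed (spectrum ℝ (schrodingerOp V)) := spectrum.isClosed _
  obtain ⟨δ, hδ, hsub⟩ := Metric.isOpen_iff.1 hcl.isOpen_compl E hE
  refine ⟨δ / 2, by positivity, fun E' hE' u => ?_⟩
  refine mul_norm_le_of_dist_spectrum (schrodingerOp_isSelfAdjoint V) (by positivity)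
    (fun x hx => ?_) u
  by_contra! hlt
  refine hsub (a := x) ?_ hx
  rw [Metric.mem_ball] at hE' ⊢
  have := dist_triangle x E' E
  rw [Real.dist_eq x E'] at this
  linarith

variable {Ω : Type*} [AddCommGroup Ω] [TopologicalSpace Ω] [CompactSpace Ω]

theorem norm_samplingPotential_sub_le (α : Ω) (f g : C(Ω, ℝ)) (ω : Ω) :
    ‖samplingPotential α f ω - samplingPotential α g ω‖ ≤ ‖f - g‖ :=
  (BoundedContinuousFunction.norm_le (norm_nonneg _)).2 fun n =>
    (f - g).norm_coe_le_norm (ω + n • α)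

theorem norm_samplingPotential_le (α : Ω) (f : C(Ω, ℝ)) (ω : Ω) :
    ‖samplingPotential α f ω‖ ≤ ‖f‖ :=
  (BoundedContinuousFunction.norm_le (norm_nonneg _)).2 fun n => f.norm_coe_le_norm (ω + n • α)

theorem samplingPotential_zero_apply (α : Ω) (f : C(Ω, ℝ)) (n : ℤ) :
    samplingPotential α f 0 n = f (n • α) := by
  rw [samplingPotential_apply, zero_add]

variable [IsTopologicalAddGroup Ω] [T2Space Ω] [TotallyDisconnectedSpace Ω] [PerfectSpace Ω]

/-- Half of `ε` opens a gap at some `E'` within `ε / 2` of `E`; the other half is the constant `E -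
E'`, which shifts that gap onto `E`. -/
theorem exists_periodic_notMem_spectrum {α : Ω} (hα : Dense (Set.range fun n : ℤ => n • α))
    {p : ℕ} (hp : IsAdmissiblePeriod α p) {f : C(Ω, ℝ)}
    (hf : ∀ n : ℤ, f ((n + p) • α) = f (n • α)) (E : ℝ) {ε : ℝ} (hε : 0 < ε) :
    ∃ q, IsAdmissiblePeriod α q ∧ ∃ g : C(Ω, ℝ), ‖g - f‖ ≤ ε ∧
      (∀ n : ℤ, g ((n + q) • α) = g (n • α)) ∧
      E ∉ spectrum ℝ (schrodingerOp (samplingPotential α g 0)) := by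
  have hper : ∀ n : ℤ, samplingPotential α f 0 (n + p) = samplingPotential α f 0 n := fun n => by
    rw [samplingPotential_zero_apply, samplingPotential_zero_apply, hf]
  obtain ⟨k₀, hk₀⟩ := exists_gap hp.1 hper (a := E - ε / 2) (b := E + ε / 2) (by linarith)
  obtain ⟨q, hq, ⟨k, hk⟩, hle⟩ := hp.exists_large hα (p * k₀)
  rw [hk] at hle
  obtain ⟨t, ht, E', hE', hgap⟩ := hk₀ k (Nat.le_of_mul_le_mul_left hle hp.1) (ε / 2)
    (by positivity)
  rw [mul_comm k p, ← hk] at hgap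
  have hfq : ∀ n : ℤ, f ((n + q) • α) = f (n • α) := by
    intro n
    have h := (Function.Periodic.nat_mul hper k) n
    rw [samplingPotential_zero_apply, samplingPotential_zero_apply] at h
    rw [← h, hk]
    push_cast
    rw [mul_comm (p : ℤ)]
  obtain ⟨g, hg⟩ := hq.exists_extension hα
    (V := fun n => f (n • α) + (if (q : ℤ) ∣ n then t else 0) + (E - E')) (fun n => by
      simp only [hfq]
      simp)
  refine ⟨q, hq, g, norm_sub_le_of_dense hα hε.le fun n => ?_, fun n => ?_, fun hmem => ?_⟩
  · have h1 : |E - E'| ≤ ε / 2 := abs_le.2 ⟨by linarith [hE'.2], by linarith [hE'.1]⟩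
    have h2 : |if (q : ℤ) ∣ n then t else 0| ≤ ε / 2 := by
      split_ifs
      · exact ht
      · rw [abs_zero]; positivity
    rw [hg, add_assoc, add_sub_cancel_left]
    exact (abs_add_le _ _).trans (by linarith)
  · rw [hg, hg, hfq]
    simp
  · set W : ℤ →ᵇ ℝ := samplingPotential α g 0 - BoundedContinuousFunction.const ℤ (E - E') with hW
    have h1 := sub_mem_spectrum_of_const (V := W) (t := E - E') (fun n => by
      rw [hW, BoundedContinuousFunction.sub_apply, BoundedContinuousFunction.const_apply,
        sub_add_cancel]) hmem
    rw [sub_sub_cancel] at h1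
    refine hgap W (fun n => ?_) h1
    rw [hW, BoundedContinuousFunction.sub_apply, BoundedContinuousFunction.const_apply,
      samplingPotential_zero_apply, samplingPotential_zero_apply, hg]
    ring

end SmallSpectrum

/-! ### Concatenation of blocks and density of small spectrum. -/

section SmallSpectrum

open Topology

/-- Block `j` occupies the residues from `2jR` up to `(2j + 2)R` modulo `N`, so its centre is `(2j +
1)R`. -/
theorem block_index_eq {N R m j : ℕ} (hR : 0 < R) (hN : 2 * m * R ≤ N) (hj : j < m) {n s : ℤ}
    (hs : (N : ℤ) ∣ s - (2 * j + 1) * R) (hns : |n - s| < R) :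
    ((n % N) / (2 * R)).toNat = j := by
  obtain ⟨k, hk⟩ := hs
  rw [abs_lt] at hns
  have hle : ((2 * j + 2) * R : ℤ) ≤ N := by
    have : (2 * j + 2) * R ≤ N := by nlinarith
    exact_mod_cast this
  have h1 : n = (n - s + (2 * j + 1) * R) + N * k := by linarith
  have hR' : (0 : ℤ) < R := by exact_mod_cast hR
  have hj0 : (0 : ℤ) ≤ 2 * j * R := by positivity
  have h2 : n % N = n - s + (2 * j + 1) * R := by
    conv_lhs => rw [h1]
    rw [Int.add_mul_emod_self_left, Int.emod_eq_of_lt] <;> linarith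
  have h3 : (n % N) / (2 * R) = j := by
    rw [h2, Int.ediv_eq_iff_of_pos (by linarith)]
    constructor <;> linarith
  rw [h3, Int.toNat_natCast]

variable {Ω : Type*} [AddCommGroup Ω] [TopologicalSpace Ω] [CompactSpace Ω]
  [IsTopologicalAddGroup Ω] [T2Space Ω] [TotallyDisconnectedSpace Ω] [PerfectSpace Ω]

/-- If finitely many periodic sampling functions near `f` have gaps that jointly cover all relevant
energies, then concatenating long blocks of them yields a function near `f` with small spectrum. -/
theorem exists_small_spectrum_of_gaps {α : Ω} (hα : Dense (Set.range fun n : ℤ => n • α))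
    {f : C(Ω, ℝ)} {ε δ κ : ℝ} (hε : 0 < ε) (hδ : 0 < δ) (hκ : 0 < κ) {ι : Type*} [Inhabited ι]
    (l : List ι) {q : ℕ} (hq : IsAdmissiblePeriod α q) (g : ι → C(Ω, ℝ)) (J : ι → Set ℝ)
    (hg : ∀ i, ‖g i - f‖ ≤ ε) (hper : ∀ i, ∀ n : ℤ, g i ((n + q) • α) = g i (n • α))
    (hgap : ∀ i ∈ l, ∀ E ∈ J i, ∀ u : EllTwo,
      δ * ‖u‖ ≤ ‖schrodingerOp (samplingPotential α (g i) 0) u - (E : ℂ) • u‖)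
    (hcover : ∀ E : ℝ, |E| ≤ 2 + (‖f‖ + ε) → ∃ i ∈ l, E ∈ J i) :
    ∃ h : C(Ω, ℝ), ‖h - f‖ ≤ ε ∧
      volume (spectrum ℝ (schrodingerOp (samplingPotential α h 0))) < ENNReal.ofReal κ := by
  set m := l.length with hm
  have hm0 : 0 < m := by
    obtain ⟨i, hi, -⟩ := hcover 0 (by rw [abs_zero]; positivity)
    exact List.length_pos_of_mem hi
  set D := 3 / δ + 12 / δ ^ 2 with hD
  have hD0 : 0 < D := by positivity
  set A := 3 + 2 * (2 + (‖f‖ + ε)) * D with hA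
  have hA0 : 0 < A := by positivity
  -- The first bound gives the smallness condition `D / R² ≤ 1 / 2`; the second makes the final
  -- total `8 m² A / R` less than `κ`.
  obtain ⟨M, hM⟩ := exists_nat_gt (max (2 * D) (8 * m ^ 2 * A / κ))
  obtain ⟨N, hN, ⟨k, hk⟩, hle⟩ := hq.exists_large hα (2 * m * (M + 1))
  set R := N / (2 * m) with hR
  have hMR : M + 1 ≤ R := by
    rw [hR, Nat.le_div_iff_mul_le (by positivity)]
    linarith
  have hNR : 2 * m * R ≤ N := Nat.mul_div_le _ _
  have hNR' : N ≤ 4 * m * R := by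
    have := Nat.lt_mul_div_succ N (b := 2 * m) (by positivity)
    rw [← hR] at this
    nlinarith
  have hR0 : 0 < R := by omega
  have hR1 : (1 : ℝ) ≤ R := by exact_mod_cast hR0
  have hMR' : (M : ℝ) < R := by exact_mod_cast hMR
  have hgN : ∀ i, ∀ n : ℤ, g i ((n + N) • α) = g i (n • α) := by
    intro i n
    have h := (Function.Periodic.nat_mul (f := fun n : ℤ => g i (n • α)) (c := (q : ℤ))
      (hper i) k) n
    simp only at h
    rw [← h, hk]
    push_cast
    rw [mul_comm (q : ℤ)]
  -- Residues beyond the last full block get `default`; any member serves, as all are within `ε` of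
  -- `f`.
  obtain ⟨h, hh⟩ := hN.exists_extension hα
    (V := fun n => g (l.getD ((n % N) / (2 * R)).toNat default) (n • α)) (fun n => by
      simp only [hgN, Int.add_emod_right])
  have hhf : ‖h - f‖ ≤ ε := norm_sub_le_of_dense hα hε.le fun n => by
    rw [hh]
    exact ((g _ - f).norm_coe_le_norm (n • α)).trans (hg _)
  refine ⟨h, hhf, ?_⟩
  set W := samplingPotential α h 0 with hW
  have hWn : ‖W‖ ≤ ‖f‖ + ε := by
    refine (norm_samplingPotential_le α h 0).trans ?_
    have := norm_le_norm_add_norm_sub' h f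
    linarith
  have hWper : ∀ n, W (n + N) = W n := fun n => by
    rw [hW, samplingPotential_zero_apply, samplingPotential_zero_apply, hh, hh, hgN,
      Int.add_emod_right]
  have hblock : ∀ j : Fin m, volume (spectrum ℝ (schrodingerOp W) ∩ J (l.get j)) ≤
      ENNReal.ofReal (8 * m * A / R) := by
    intro j
    -- For energies in the gap of block `j` the cut goes through the centre of that block, where the
    -- potential agrees with its periodic model out to distance `R`.
    have h1 := volume_spectrum_inter_le (W := W) (W' := samplingPotential α (g (l.get j)) 0)
      (N := N) (c := (2 * j + 1) * R) (R := R) (J := J (l.get j)) (by nlinarith) hWper hR1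
      (fun n s hs hns => by
        have hns' : |n - s| < R := by exact_mod_cast hns
        rw [hW, samplingPotential_zero_apply, samplingPotential_zero_apply, hh,
          block_index_eq hR0 hNR j.2 hs hns', List.getD_eq_getElem _ _ j.2]
        rfl) hδ (hgap _ (List.get_mem _ _)) (by
          rw [div_le_iff₀ (by positivity)]
          have := (le_max_left _ _).trans_lt hM
          nlinarith)
    refine h1.trans (ENNReal.ofReal_le_ofReal ?_)
    have hNc : (N : ℝ) ≤ 4 * m * R := by exact_mod_cast hNR'
    have hAW : 3 + 2 * (2 + ‖W‖) * D ≤ A := by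
      rw [hA]; gcongr
    calc (N : ℝ) * (2 * ((3 + 2 * (2 + ‖W‖) * D) / R ^ 2))
        ≤ 4 * m * R * (2 * (A / R ^ 2)) := by gcongr
      _ = 8 * m * A / R := by field_simp; norm_num
  have hsub : spectrum ℝ (schrodingerOp W) ⊆
      ⋃ j : Fin m, spectrum ℝ (schrodingerOp W) ∩ J (l.get j) := by
    intro E hE
    obtain ⟨i, hi, hEi⟩ := hcover E ((abs_le_of_mem_spectrum hE).trans (by linarith))
    obtain ⟨j, rfl⟩ := List.get_of_mem hi
    exact Set.mem_iUnion.2 ⟨j, hE, hEi⟩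
  calc volume (spectrum ℝ (schrodingerOp W))
      ≤ ∑ j : Fin m, volume (spectrum ℝ (schrodingerOp W) ∩ J (l.get j)) :=
        (measure_mono hsub).trans (measure_iUnion_fintype_le _ _)
    _ ≤ ∑ _j : Fin m, ENNReal.ofReal (8 * m * A / R) := Finset.sum_le_sum fun j _ => hblock j
    _ = ENNReal.ofReal (m * (8 * m * A / R)) := by
      rw [Finset.sum_const, Finset.card_univ, Fintype.card_fin, nsmul_eq_mul,
        ENNReal.ofReal_mul (Nat.cast_nonneg m), ENNReal.ofReal_natCast]
    _ < ENNReal.ofReal κ := by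
      rw [ENNReal.ofReal_lt_ofReal_iff hκ]
      have h1 := ((le_max_right _ _).trans_lt hM).trans hMR'
      rw [div_lt_iff₀ hκ] at h1
      rw [← mul_div_assoc, div_lt_iff₀ (by linarith)]
      linarith

/-- Gaps are open, so finitely many cover the compact range of possible energies, with a common gap
size and a common period. -/
theorem exists_small_spectrum {α : Ω} (hα : Dense (Set.range fun n : ℤ => n • α)) (f : C(Ω, ℝ))
    {ε κ : ℝ} (hε : 0 < ε) (hκ : 0 < κ) : ∃ h : C(Ω, ℝ), ‖h - f‖ ≤ ε ∧
      volume (spectrum ℝ (schrodingerOp (samplingPotential α h 0))) < ENNReal.ofReal κ := by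
  obtain ⟨p, hp, f₀, hf₀, hper₀⟩ := exists_periodic_approx hα f (half_pos hε)
  choose r hr g hg hper hgap using
    fun E => exists_periodic_notMem_spectrum hα hp hper₀ E (half_pos hε)
  choose δ hδ hδgap using fun E => exists_uniform_gap (hgap E)
  obtain ⟨t, -, ht⟩ := (isCompact_Icc (a := -(2 + (‖f₀‖ + ε / 2)))
    (b := 2 + (‖f₀‖ + ε / 2))).elim_nhds_subcover (fun E => Metric.ball E (δ E))
      fun E _ => Metric.ball_mem_nhds E (hδ E)
  have hne : t.Nonempty := by
    obtain ⟨i, hi, -⟩ := Set.mem_iUnion₂.1 (ht (show (0 : ℝ) ∈ _ from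
      ⟨by linarith [norm_nonneg f₀], by positivity⟩))
    exact ⟨i, hi⟩
  obtain ⟨E₀, hE₀, hmin⟩ := t.exists_min_image δ hne
  obtain ⟨s, hs, -, hrs⟩ := exists_common_admissiblePeriod hp t (r := r) fun E _ => hr E
  have : Inhabited t := ⟨⟨E₀, hE₀⟩⟩
  obtain ⟨h, hhf, hvol⟩ := exists_small_spectrum_of_gaps hα (f := f₀) (half_pos hε) (hδ E₀) hκ
    (Finset.univ : Finset t).toList hs (fun E => g E) (fun E => Metric.ball (E : ℝ) (δ E))
    (fun E => hg E) (fun E n => by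
      obtain ⟨k, hk⟩ := hrs E E.2
      have h := (Function.Periodic.nat_mul (f := fun n : ℤ => g E (n • α)) (c := (r E : ℤ))
        (hper E) k) n
      simp only at h
      rw [← h, hk]
      push_cast
      rw [mul_comm (k : ℤ)])
    (fun E _ E' hE' u => (mul_le_mul_of_nonneg_right (hmin E E.2) (norm_nonneg u)).trans
      (hδgap E E' hE' u))
    (fun E hE => by
      obtain ⟨i, hi, hEi⟩ := Set.mem_iUnion₂.1 (ht (abs_le.1 hE))
      exact ⟨⟨i, hi⟩, by simp, hEi⟩)
  refine ⟨h, ?_, hvol⟩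
  have := norm_sub_le_norm_sub_add_norm_sub h f₀ f
  linarith

end SmallSpectrum

/-! ### Translates of the potential and decay of eigenfunctions. -/

section Translation

open Topology Filter

theorem norm_schrodingerOp_translate_sub_le {V W : ℤ →ᵇ ℝ} {k : ℤ} {ε : ℝ} (hε : 0 ≤ ε)
    (h : ∀ n, |W (n + k) - V n| ≤ ε) (E : ℂ) (u : EllTwo) :
    ‖schrodingerOp W (EllTwo.translate (-k) u) - E • EllTwo.translate (-k) u‖ ≤
      ‖schrodingerOp V u - E • u‖ + ε * ‖u‖ := by
  set D : ℤ →ᵇ ℝ :=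
    W.compContinuous ⟨fun n => n + k, continuous_of_discreteTopology⟩ - V with hD
  have e : schrodingerOp W (EllTwo.translate (-k) u) - E • EllTwo.translate (-k) u =
      EllTwo.translate (-k) ((schrodingerOp V u - E • u) + EllTwo.mulOp D u) := by
    ext n
    have hDn : D (n + -k) = W n - V (n + -k) := by
      change W (n + -k + k) - V (n + -k) = _
      rw [neg_add_cancel_right]
    rw [EllTwo.translate_apply]
    simp only [lp.coeFn_sub, lp.coeFn_add, lp.coeFn_smul, Pi.sub_apply, Pi.add_apply,
      Pi.smul_apply, schrodingerOp_apply, EllTwo.mulOp_apply, EllTwo.translate_apply,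
      smul_eq_mul, hDn]
    rw [add_right_comm n 1, ← sub_add_eq_add_sub n 1]
    push_cast
    ring
  rw [e, (EllTwo.translate (-k)).norm_map]
  exact (norm_add_le _ _).trans (add_le_add le_rfl (norm_mulOp_apply_le hε h u))

/-- Approximate eigenvectors of one operator, translated, serve for the other; the spectrum is
closed. -/
theorem mem_spectrum_of_translates_close {V W : ℤ →ᵇ ℝ} {E : ℝ}
    (hE : E ∈ spectrum ℝ (schrodingerOp V))
    (h : ∀ ε > 0, ∃ k : ℤ, ∀ n, |W (n + k) - V n| ≤ ε) :
    E ∈ spectrum ℝ (schrodingerOp W) := by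
  have hcl : IsClosed (spectrum ℝ (schrodingerOp W)) := spectrum.isClosed _
  rw [← hcl.closure_eq, Metric.mem_closure_iff]
  intro ε hε
  obtain ⟨k, hk⟩ := h (ε / 3) (by positivity)
  obtain ⟨u, hu, hu'⟩ := exists_approx_eigenvector (schrodingerOp_isSelfAdjoint V) hE
    (ε := ε / 3) (by positivity)
  have hpos := norm_pos_iff.2 hu
  have h1 := norm_schrodingerOp_translate_sub_le (by positivity) hk E u
  have h2 : EllTwo.translate (-k) u ≠ 0 := by
    rw [← norm_pos_iff, (EllTwo.translate (-k)).norm_map]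
    exact hpos
  obtain ⟨x, hx, hxE⟩ := exists_mem_spectrum_abs_sub_le (schrodingerOp_isSelfAdjoint W) h2
    (η := ε) (by
      refine h1.trans_lt ?_
      rw [(EllTwo.translate (-k)).norm_map]
      nlinarith)
  exact ⟨x, hx, by rwa [Real.dist_eq, abs_sub_comm]⟩

theorem tendsto_cofinite_ellTwo (u : EllTwo) : Tendsto (fun n => ‖u n‖) cofinite (𝓝 0) := by
  have h := ((lp.memℓp u).summable (by norm_num)).tendsto_cofinite_zero
  have h2 : Tendsto (fun n => √(‖u n‖ ^ (2 : ENNReal).toReal)) cofinite (𝓝 √0) :=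
    (Real.continuous_sqrt.tendsto 0).comp h
  simpa using h2

/-- Eigenfunctions are controlled by their values at two neighbouring sites. -/
theorem exists_norm_le_of_eigenvector (V : ℤ →ᵇ ℝ) (E : ℂ) :
    ∃ C : ℝ, 0 ≤ C ∧ ∀ w : EllTwo, schrodingerOp V w = E • w →
      ‖w‖ ≤ C * max ‖w 0‖ ‖w 1‖ := by
  set K : Submodule ℂ EllTwo :=
    LinearMap.ker (schrodingerOp V - E • ContinuousLinearMap.id ℂ EllTwo).toLinearMap with hK
  have hmem : ∀ w, w ∈ K ↔ schrodingerOp V w = E • w := fun w => by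
    rw [hK, LinearMap.mem_ker]
    exact sub_eq_zero
  let L : K →ₗ[ℂ] ℂ × ℂ :=
    { toFun := fun w => ((w : EllTwo) 0, (w : EllTwo) 1)
      map_add' := fun _ _ => rfl
      map_smul' := fun _ _ => rfl }
  have hL : LinearMap.ker L = ⊥ := by
    rw [LinearMap.ker_eq_bot']
    rintro ⟨w, hw⟩ h0
    have hw0 : w 0 = 0 := congrArg Prod.fst h0
    have hw1 : w 1 = 0 := congrArg Prod.snd h0
    rw [hmem] at hw
    have heq : ∀ n, w (n - 1) + w (n + 1) + (V n : ℂ) * w n = E * w n := fun n => by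
      rw [← schrodingerOp_apply, hw]; rfl
    have hall : ∀ n : ℤ, w n = 0 ∧ w (n + 1) = 0 := by
      intro n
      induction n using Int.induction_on with
      | zero => exact ⟨hw0, by simpa using hw1⟩
      | succ n ih =>
        refine ⟨ih.2, ?_⟩
        have := heq (n + 1)
        rw [add_sub_cancel_right, ih.1, ih.2] at this
        simpa using this
      | pred n ih =>
        refine ⟨?_, by rw [sub_add_cancel]; exact ih.1⟩
        have := heq (-n)
        rw [ih.1, ih.2] at this
        simpa using this
    ext n
    exact (hall n).1
  have : FiniteDimensional ℂ K := FiniteDimensional.of_injective L (LinearMap.ker_eq_bot.1 hL)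
  obtain ⟨C, -, hC⟩ := L.exists_antilipschitzWith hL
  refine ⟨C, C.2, fun w hw => ?_⟩
  have := hC.le_mul_dist ⟨w, (hmem w).2 hw⟩ 0
  rw [dist_zero_right, map_zero, dist_zero_right] at this
  exact this

end Translation

/-! ### Invariance, openness, perfectness and the Baire argument. -/

section Spectrum

open Topology Filter

theorem isTotallyDisconnected_of_volume_eq_zero {K : Set ℝ} (hK : volume K = 0) :
    IsTotallyDisconnected K := by
  intro t htK ht x hx y hy
  by_contra hne
  wlog hxy : x < y generalizing x y
  · exact this hy hx (Ne.symm hne) (lt_of_le_of_ne (not_lt.1 hxy) (Ne.symm hne))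
  have h1 : volume (Set.Icc x y) ≤ volume K := measure_mono ((ht.Icc_subset hx hy).trans htK)
  rw [hK, Real.volume_Icc, nonpos_iff_eq_zero, ENNReal.ofReal_eq_zero] at h1
  linarith

variable {Ω : Type*} [AddCommGroup Ω] [TopologicalSpace Ω] [CompactSpace Ω]

theorem schrodingerSpectrum_eq (α : Ω) (f : C(Ω, ℝ)) (ω : Ω) :
    schrodingerSpectrum α f ω = spectrum ℝ (schrodingerOp (samplingPotential α f ω)) := by
  ext E
  exact ofReal_mem_spectrum_iff

theorem isCompact_schrodingerSpectrum (α : Ω) (f : C(Ω, ℝ)) (ω : Ω) :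
    IsCompact (schrodingerSpectrum α f ω) := by
  rw [schrodingerSpectrum_eq]
  exact spectrum.isCompact _

theorem nonempty_schrodingerSpectrum (α : Ω) (f : C(Ω, ℝ)) (ω : Ω) :
    (schrodingerSpectrum α f ω).Nonempty := by
  rw [schrodingerSpectrum_eq]
  have : Nontrivial (EllTwo →L[ℂ] EllTwo) := by
    refine ⟨⟨1, 0, fun h => ?_⟩⟩
    have := congrArg (fun T : EllTwo →L[ℂ] EllTwo => (T (lp.single 2 0 1) : ℤ → ℂ) 0) h
    simp [lp.single_apply] at this
  exact IsSelfAdjoint.nonempty_spectrum_real (schrodingerOp_isSelfAdjoint _)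

theorem isOpen_volume_spectrum_lt (α : Ω) (r : ENNReal) :
    IsOpen {f : C(Ω, ℝ) | volume (schrodingerSpectrum α f 0) < r} := by
  rw [Metric.isOpen_iff]
  intro f hf
  obtain ⟨U, hfU, hU, hUr⟩ := Set.exists_isOpen_lt_of_lt _ r hf
  obtain ⟨δ, hδ, hthick⟩ := (isCompact_schrodingerSpectrum α f 0).exists_thickening_subset_open
    hU hfU
  refine ⟨δ, hδ, fun g hg => lt_of_le_of_lt (measure_mono fun E hE => ?_) hUr⟩
  refine hthick (Metric.mem_thickening_iff.2 ?_)
  rw [schrodingerSpectrum_eq] at hE ⊢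
  rw [Metric.mem_ball, dist_eq_norm] at hg
  obtain ⟨x, hx, hxE⟩ := exists_mem_spectrum_of_norm_sub_lt (schrodingerOp_isSelfAdjoint _)
    (schrodingerOp_isSelfAdjoint _) (((norm_schrodingerOp_sub_le _ _).trans
      (norm_samplingPotential_sub_le α g f 0)).trans_lt hg) hE
  exact ⟨x, hx, by rwa [Real.dist_eq, abs_sub_comm]⟩

variable [IsTopologicalAddGroup Ω]

/-- Density of the orbit brings `ω' + k • α` arbitrarily close to `ω`, and `f` is uniformly
continuous. -/
theorem schrodingerSpectrum_subset {α : Ω} (hα : Dense (Set.range fun n : ℤ => n • α))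
    (f : C(Ω, ℝ)) (ω ω' : Ω) : schrodingerSpectrum α f ω ⊆ schrodingerSpectrum α f ω' := by
  intro E hE
  rw [schrodingerSpectrum_eq] at hE ⊢
  refine mem_spectrum_of_translates_close hE fun ε hε => ?_
  have hnhds : ∀ᶠ y in 𝓝 (ω - ω'), ∀ x, |f (x + (ω' + y - ω)) - f x| < ε := by
    have hc : Tendsto (fun y => ω' + y - ω) (𝓝 (ω - ω')) (𝓝 0) := by
      have : Continuous fun y : Ω => ω' + y - ω := by fun_prop
      have h := this.tendsto (ω - ω')
      have e : ω' + (ω - ω') - ω = 0 := by abel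
      rwa [e] at h
    exact hc.eventually (eventually_forall_abs_sub_lt f hε)
  obtain ⟨_, hy, k, rfl⟩ := (mem_closure_iff_nhds.1 (hα (ω - ω'))) _ hnhds
  refine ⟨k, fun n => ?_⟩
  have := hy (ω + n • α)
  rw [samplingPotential_apply, samplingPotential_apply]
  have e : ω + n • α + (ω' + k • α - ω) = ω' + (n + k) • α := by rw [add_smul]; abel
  simp only [e] at this
  exact this.le

/-- An isolated point would be an eigenvalue. Translating its eigenfunction far along almost periods
gives vectors of fixed norm close to the eigenspace but tiny at the sites `0` and `1`, whereas those
two values control the norm on the eigenspace. -/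
theorem preperfect_schrodingerSpectrum [T2Space Ω] [TotallyDisconnectedSpace Ω] (α : Ω)
    (f : C(Ω, ℝ)) : Preperfect (schrodingerSpectrum α f 0) := by
  intro E hE
  by_contra hacc
  rw [schrodingerSpectrum_eq] at hE hacc
  set V := samplingPotential α f 0 with hV
  rw [accPt_iff_nhds] at hacc
  push Not at hacc
  obtain ⟨s, hs, hiso⟩ := hacc
  obtain ⟨δ, hδ, hball⟩ := Metric.mem_nhds_iff.1 hs
  obtain ⟨P, B, hP, hTP, hB⟩ := exists_projection_of_isolated (schrodingerOp_isSelfAdjoint V) hδ hE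
    fun x hx hxE => by
      by_contra! hlt
      exact hxE (hiso x ⟨hball (by rwa [Metric.mem_ball, Real.dist_eq]), hx⟩)
  obtain ⟨v, hv⟩ : ∃ v, P v ≠ 0 := by
    by_contra! h
    exact hP (ContinuousLinearMap.ext h)
  set u := P v with hu
  have hHu : schrodingerOp V u = (E : ℂ) • u := hTP v
  obtain ⟨C, hC0, hC⟩ := exists_norm_le_of_eigenvector V E
  have hbound : ∀ ε > 0, ‖u‖ ≤ ε * (C + C * (‖B‖ * ‖u‖) + ‖B‖ * ‖u‖) := by
    intro ε hε
    obtain ⟨q, hq, hqper⟩ := exists_almostPeriod α f hε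
    -- All multiples of `q` are almost periods with the same `ε`, so `j` can be taken large enough
    -- for the decay of `u`.
    obtain ⟨j, hj0, hj1⟩ : ∃ j : ℕ, ‖u ((j : ℤ) * q)‖ < ε ∧ ‖u ((j : ℤ) * q + 1)‖ < ε := by
      have hq0 : (q : ℤ) ≠ 0 := by exact_mod_cast hq.1.ne'
      have hi : ∀ c : ℤ, Function.Injective fun j : ℕ => (j : ℤ) * q + c := fun c a b hab => by
        have := mul_right_cancel₀ hq0 (add_right_cancel hab)
        exact_mod_cast this
      have ht := fun c => ((tendsto_cofinite_ellTwo u).comp (hi c).tendsto_cofinite).eventually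
        (gt_mem_nhds hε)
      obtain ⟨j, h0, h1⟩ := ((ht 0).and (ht 1)).exists
      exact ⟨j, by simpa using h0, h1⟩
    set y := EllTwo.translate ((j : ℤ) * q) u with hy
    have hyn : ‖y‖ = ‖u‖ := (EllTwo.translate _).norm_map u
    have hHy : ‖schrodingerOp V y - (E : ℂ) • y‖ ≤ ε * ‖u‖ := by
      have := norm_schrodingerOp_translate_sub_le (V := V) (W := V) (k := -((j : ℤ) * q)) hε.le
        (fun n => by
          rw [hV, samplingPotential_zero_apply, samplingPotential_zero_apply, ← neg_mul]
          exact (hqper n (-j)).le) E u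
      rwa [neg_neg, hHu, sub_self, norm_zero, zero_add] at this
    have hyP : ‖y - P y‖ ≤ ε * (‖B‖ * ‖u‖) := by
      rw [hB]
      refine (B.le_opNorm _).trans ?_
      calc ‖B‖ * ‖schrodingerOp V y - (E : ℂ) • y‖ ≤ ‖B‖ * (ε * ‖u‖) := by gcongr
        _ = _ := by ring
    have hPy : ∀ n, ‖y n‖ < ε → ‖P y n‖ ≤ ε + ε * (‖B‖ * ‖u‖) := by
      intro n hn
      have h1 : ‖(y - P y) n‖ ≤ ‖y - P y‖ := lp.norm_apply_le_norm (by norm_num) _ n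
      rw [lp.coeFn_sub, Pi.sub_apply] at h1
      have h2 := norm_le_norm_add_norm_sub (y n) (P y n)
      linarith
    have h0 : ‖y 0‖ < ε := by rwa [hy, EllTwo.translate_apply, zero_add]
    have h1 : ‖y 1‖ < ε := by rwa [hy, EllTwo.translate_apply, add_comm]
    have h2 := (hC (P y) (hTP y)).trans
      (mul_le_mul_of_nonneg_left (max_le (hPy 0 h0) (hPy 1 h1)) hC0)
    have h3 := norm_le_norm_add_norm_sub' y (P y)
    rw [hyn] at h3
    linarith
  have hlim : Tendsto (fun ε : ℝ => ε * (C + C * (‖B‖ * ‖u‖) + ‖B‖ * ‖u‖)) (𝓝[>] 0) (𝓝 0) := by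
    have : Continuous fun ε : ℝ => ε * (C + C * (‖B‖ * ‖u‖) + ‖B‖ * ‖u‖) := by fun_prop
    have h := (this.tendsto 0).mono_left (nhdsWithin_le_nhds (s := Set.Ioi 0))
    rwa [zero_mul] at h
  have hle := ge_of_tendsto hlim (eventually_nhdsWithin_of_forall hbound)
  exact hv (norm_le_zero_iff.1 hle)

theorem exists_generic_cantor_spectrum [T2Space Ω] [TotallyDisconnectedSpace Ω] [PerfectSpace Ω]
    (α : Ω) (hα : Dense (Set.range fun n : ℤ => n • α)) :
    ∃ Sigma : C(Ω, ℝ) → Set ℝ,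
      (∀ (f : C(Ω, ℝ)) (ω : Ω), schrodingerSpectrum α f ω = Sigma f) ∧
      ∃ 𝒞 : Set C(Ω, ℝ), IsGδ 𝒞 ∧ Dense 𝒞 ∧
        ∀ f ∈ 𝒞, IsCantorSet (Sigma f) ∧ volume (Sigma f) = 0 := by
  refine ⟨fun f => schrodingerSpectrum α f 0, fun f ω =>
    (schrodingerSpectrum_subset hα f ω 0).antisymm (schrodingerSpectrum_subset hα f 0 ω), ?_⟩
  set O : ℕ → Set C(Ω, ℝ) := fun m =>
    {f | volume (schrodingerSpectrum α f 0) < ENNReal.ofReal (1 / (m + 1))} with hO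
  have hopen : ∀ m, IsOpen (O m) := fun m => isOpen_volume_spectrum_lt α _
  have hdense : ∀ m, Dense (O m) := by
    intro m
    rw [Metric.dense_iff]
    intro f ε hε
    obtain ⟨h, hhf, hvol⟩ := exists_small_spectrum hα f (half_pos hε)
      (κ := 1 / ((m : ℝ) + 1)) (by positivity)
    refine ⟨h, ?_, ?_⟩
    · rw [Metric.mem_ball, dist_eq_norm]
      linarith
    · change volume (schrodingerSpectrum α h 0) < _
      rwa [schrodingerSpectrum_eq]
  refine ⟨⋂ m, O m, IsGδ.iInter_of_isOpen hopen, dense_iInter_of_isOpen hopen hdense,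
    fun f hf => ?_⟩
  have hzero : volume (schrodingerSpectrum α f 0) = 0 := by
    have hlim : Tendsto (fun m : ℕ => ENNReal.ofReal (1 / ((m : ℝ) + 1))) atTop (𝓝 0) := by
      rw [← ENNReal.ofReal_zero]
      exact ENNReal.tendsto_ofReal tendsto_one_div_add_atTop_nhds_zero_nat
    exact nonpos_iff_eq_zero.1 (ge_of_tendsto' hlim fun m => (Set.mem_iInter.1 hf m).le)
  have hcomp := isCompact_schrodingerSpectrum α f 0
  exact ⟨⟨nonempty_schrodingerSpectrum α f 0, hcomp,
    ⟨hcomp.isClosed, preperfect_schrodingerSpectrum α f⟩,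
    isTotallyDisconnected_of_volume_eq_zero hzero⟩, hzero⟩

end Spectrum

theorem add_comm_of_dense_zmultiples {Ω : Type*} [AddGroup Ω] [TopologicalSpace Ω]
    [IsTopologicalAddGroup Ω] [T2Space Ω] {α : Ω}
    (hα : Dense (Set.range fun n : ℤ => n • α)) (x y : Ω) : x + y = y + x := by
  have hcl : IsClosed {p : Ω × Ω | p.1 + p.2 = p.2 + p.1} :=
    isClosed_eq (continuous_fst.add continuous_snd) (continuous_snd.add continuous_fst)
  have hsub : (Set.range fun n : ℤ => n • α) ×ˢ (Set.range fun n : ℤ => n • α) ⊆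
      {p : Ω × Ω | p.1 + p.2 = p.2 + p.1} := by
    rintro ⟨_, _⟩ ⟨⟨n, rfl⟩, ⟨m, rfl⟩⟩
    change n • α + m • α = m • α + n • α
    rw [← add_zsmul, ← add_zsmul, add_comm]
  exact hcl.closure_subset_iff.2 hsub ((hα.prod hα) (x, y))

theorem theoremt {Ω : Type*} [AddGroup Ω] [TopologicalSpace Ω] [IsTopologicalAddGroup Ω]
    [T2Space Ω] [CompactSpace Ω] [TotallyDisconnectedSpace Ω] [PerfectSpace Ω]
    (α : Ω) (hα : Dense (Set.range fun n : ℤ => n • α)) :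
    ∃ Sigma : C(Ω, ℝ) → Set ℝ,
      (∀ (f : C(Ω, ℝ)) (ω : Ω), schrodingerSpectrum α f ω = Sigma f) ∧
      ∃ 𝒞 : Set C(Ω, ℝ), IsGδ 𝒞 ∧ Dense 𝒞 ∧
        ∀ f ∈ 𝒞, IsCantorSet (Sigma f) ∧ volume (Sigma f) = 0 := by
  -- Commutativity is added on top of the given group structure, so the operators and spectra are
  -- unchanged.
  let _ : AddCommGroup Ω := { ‹AddGroup Ω› with add_comm := add_comm_of_dense_zmultiples hα }
  exact exists_generic_cantor_spectrum α hα
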